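/- Let $V$ be an $8$-dimensional real vector space with a positive definite inner product $g$ and a hyper-Hermitian structure, i.e. endomorphisms $J_1,J_2,J_3$ with $J_1J_2=-J_2J_1=J_3$, $J_s^2=-\mathrm{Id}$ and $g(J_sx,J_sy)=g(x,y)$ for $s=1,2,3$. Let $$sp(2)=\{A\in\mathrm{End}(V): g(Ax,y)+g(x,Ay)=0,\ AJ_s=J_sA,\ s=1,2,3\}$$ with the commutator bracket. A hyper-Kähler curvature-type tensor is a real $4$-tensor $K\in\Lambda^2V^*\otimes\Lambda^2V^*$ such that $$K(x,y,z,w)+K(y,z,x,w)+K(z,x,y,w)=0,\qquad K(x,y,J_sz,J_sw)=K(x,y,z,w)$$ for all $x,y,z,w\in V$ and $s=1,2,3$. For such $K$ let $\mathcal T_K\in\mathrm{End}(sp(2))$ be defined by $$g(\mathcal T_K(A)x,y)=\tfrac12\sum_{a=1}^{8}K(x,y,h_a,Ah_a),$$ where $\{h_a\}$ is any orthonormal basis of $V$. Extend all tensors complex-multilinearly to $V^{\mathbb C}=V\otimes_{\mathbb R}\mathbb C$. Let $W\subset V^{\mathbb C}$ be the $i$-eigenspace of $J_1$, and for $x,y\in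 W$ put $j(x)=J_2\bar x$ and $\pi(x,y)=-g(x,J_2y)$. A basis $e_1,\dots,e_4$ of $W$, with dual basis $e^1,\dots,e^4$, is called $Sp(2)$-adapted if $e_3=j(e_1)$, $e_4=j(e_2)$ and $\pi=e^1\wedge e^3+e^2\wedge e^4$. Let $\mathcal C$ (the orbit of the cubic discriminant) be the set of all hyper-Kähler curvature-type tensors $K$ for which the tensor $$S(x,y,z,w)=\tfrac12\big(K(x,J_2y,z,J_2w)-K(x,J_3y,z,J_3w)\big)$$ satisfies, for some $Sp(2)$-adapted basis $\{e_\alpha\}$ of $W$ and all $x=\sum_\alpha x_\alpha e_\alpha\in W$, $$S(x,x,x,x)=-18\,x_1x_2x_3x_4+4\sqrt3\,x_1x_4^3-4\sqrt3\,x_2^3x_3+3\,x_2^2x_4^2-9\,x_1^2x_3^2 .$$ (With $x_1=a$, $x_2=b/\sqrt3$, $x_3=d$, $x_4=-c/\sqrt3$, three times the right-hand side is the discriminant of the cubic $az^3+bz^2+cz+d$.) **Theorem.** A hyper-Kähler curvature-type tensor $K$ on $V$ belongs to $\mathcal C$ if and only if $\mathcal T_K$ satisfies the following two conditions: (I) $(2\mathcal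 T_K-7\,\mathrm{Id})(2\mathcal T_K+3\,\mathrm{Id})=0$; (II) for all $A,B\in sp(2)$, $$[\mathcal T_KA,\mathcal T_KB]-\mathcal T_K[\mathcal T_KA,B]=\tfrac32\big(\mathcal T_K[A,B]-[A,\mathcal T_KB]\big).$$ -/

import Mathlib

open scoped TensorProduct InnerProductSpace

noncomputable section

set_option maxSynthPendingDepth 3

namespace CubicDiscriminant

/-- A hyper-Hermitian structure on a real inner product space `V` (the metric `g` is the inner
product of `V`). -/
structure HyperHermitian (V : Type*) [NormedAddCommGroup V] [InnerProductSpace ℝ V] where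
  J₁ : V →ₗ[ℝ] V
  J₂ : V →ₗ[ℝ] V
  J₃ : V →ₗ[ℝ] V
  J₁_mul_J₂ : J₁ ∘ₗ J₂ = J₃
  J₂_mul_J₁ : -(J₂ ∘ₗ J₁) = J₃
  J₁_sq : J₁ ∘ₗ J₁ = -LinearMap.id
  J₂_sq : J₂ ∘ₗ J₂ = -LinearMap.id
  J₃_sq : J₃ ∘ₗ J₃ = -LinearMap.id
  J₁_isometry : ∀ x y, ⟪J₁ x, J₁ y⟫_ℝ = ⟪x, y⟫_ℝ
  J₂_isometry : ∀ x y, ⟪J₂ x, J₂ y⟫_ℝ = ⟪x, y⟫_ℝ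
  J₃_isometry : ∀ x y, ⟪J₃ x, J₃ y⟫_ℝ = ⟪x, y⟫_ℝ

/-- Real covariant 4-tensors on `V`. -/
abbrev Tensor4 (V : Type*) [AddCommGroup V] [Module ℝ V] : Type _ :=
  V →ₗ[ℝ] V →ₗ[ℝ] V →ₗ[ℝ] V →ₗ[ℝ] ℝ

/-! ### Complexification -/

/-- The complexification `V ⊗ ℂ` of `V`. -/
abbrev Complexify (V : Type*) [AddCommGroup V] [Module ℝ V] : Type _ := ℂ ⊗[ℝ] V

section Complexification

variable {V : Type*} [AddCommGroup V] [Module ℝ V]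

/-- Complex conjugation on the complexification, `z ⊗ v ↦ z̄ ⊗ v`. -/
def conjC : Complexify V →ₗ[ℝ] Complexify V :=
  LinearMap.rTensor V Complex.conjAe.toLinearMap

/-- The complex linear extension `z ⊗ v ↦ z ⊗ f v` of an endomorphism `f` of `V`. -/
def endC (f : V →ₗ[ℝ] V) : Complexify V →ₗ[ℂ] Complexify V :=
  f.baseChange ℂ

/-- The complex linear extension `z ⊗ v ↦ z • f v` of a real linear map into a complex space. -/
def extendC {M : Type*} [AddCommGroup M] [Module ℝ M] [Module ℂ M] [IsScalarTower ℝ ℂ M] :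
    (V →ₗ[ℝ] M) →ₗ[ℝ] (Complexify V →ₗ[ℂ] M) :=
  (LinearMap.liftBaseChangeEquiv (R := ℝ) (M := V) (N := M) ℂ).toLinearMap.restrictScalars ℝ

/-- The complex bilinear extension of a real bilinear form. -/
def bilinC (B : V →ₗ[ℝ] V →ₗ[ℝ] ℝ) : Complexify V →ₗ[ℂ] Complexify V →ₗ[ℂ] ℂ :=
  extendC ((extendC ∘ₗ LinearMap.compRight ℝ Complex.ofRealCLM.toLinearMap) ∘ₗ B)

/-- The complex multilinear extension of a real covariant 4-tensor. -/
def tensor4C (K : Tensor4 V) : Complexify V →ₗ[ℂ] Complexify V →ₗ[ℂ]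
    Complexify V →ₗ[ℂ] Complexify V →ₗ[ℂ] ℂ :=
  extendC <| (extendC ∘ₗ LinearMap.compRight ℝ
    (extendC ∘ₗ LinearMap.compRight ℝ
      (extendC ∘ₗ LinearMap.compRight ℝ Complex.ofRealCLM.toLinearMap))) ∘ₗ K

theorem tensor4C_tmul (K : Tensor4 V) (a b c d : ℂ) (x y z w : V) :
    tensor4C K (a ⊗ₜ x) (b ⊗ₜ y) (c ⊗ₜ z) (d ⊗ₜ w) = a * b * c * d * (K x y z w : ℂ) := by
  simp [tensor4C, extendC]
  ring

theorem bilinC_tmul (B : V →ₗ[ℝ] V →ₗ[ℝ] ℝ) (a b : ℂ) (x y : V) :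
    bilinC B (a ⊗ₜ x) (b ⊗ₜ y) = a * b * (B x y : ℂ) := by
  simp [bilinC, extendC]
  ring

end Complexification

namespace HyperHermitian

attribute [local instance 100] LieRing.ofAssociativeRing

variable {V : Type*} [NormedAddCommGroup V] [InnerProductSpace ℝ V] (H : HyperHermitian V)

/-- The Lie algebra `sp(n)`: skew-symmetric endomorphisms of `V` commuting with `J₁, J₂, J₃`. -/
def sp : LieSubalgebra ℝ (Module.End ℝ V) where
  carrier := {A | (∀ x y, ⟪A x, y⟫_ℝ + ⟪x, A y⟫_ℝ = 0) ∧
    A ∘ₗ H.J₁ = H.J₁ ∘ₗ A ∧ A ∘ₗ H.J₂ = H.J₂ ∘ₗ A ∧ A ∘ₗ H.J₃ = H.J₃ ∘ₗ A}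
  add_mem' := by
    rintro A B ⟨hA, hA1, hA2, hA3⟩ ⟨hB, hB1, hB2, hB3⟩
    refine ⟨fun x y => ?_, ?_, ?_, ?_⟩
    · simp only [LinearMap.add_apply, inner_add_left, inner_add_right]
      linarith [hA x y, hB x y]
    · rw [LinearMap.add_comp, LinearMap.comp_add, hA1, hB1]
    · rw [LinearMap.add_comp, LinearMap.comp_add, hA2, hB2]
    · rw [LinearMap.add_comp, LinearMap.comp_add, hA3, hB3]
  zero_mem' := by
    refine ⟨fun x y => by simp, ?_, ?_, ?_⟩ <;> simp
  smul_mem' := by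
    rintro c A ⟨hA, hA1, hA2, hA3⟩
    refine ⟨fun x y => ?_, ?_, ?_, ?_⟩
    · simp only [LinearMap.smul_apply, real_inner_smul_left, real_inner_smul_right]
      rw [← mul_add, hA x y, mul_zero]
    · rw [LinearMap.smul_comp, LinearMap.comp_smul, hA1]
    · rw [LinearMap.smul_comp, LinearMap.comp_smul, hA2]
    · rw [LinearMap.smul_comp, LinearMap.comp_smul, hA3]
  lie_mem' := by
    rintro A B ⟨hA, hA1, hA2, hA3⟩ ⟨hB, hB1, hB2, hB3⟩
    have key : ∀ J : V →ₗ[ℝ] V, A ∘ₗ J = J ∘ₗ A → B ∘ₗ J = J ∘ₗ B →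
        ⁅A, B⁆ ∘ₗ J = J ∘ₗ ⁅A, B⁆ := by
      intro J h1 h2
      have h1' : ∀ x, A (J x) = J (A x) := fun x => LinearMap.congr_fun h1 x
      have h2' : ∀ x, B (J x) = J (B x) := fun x => LinearMap.congr_fun h2 x
      ext x
      simp [LieRing.of_associative_ring_bracket, h1', h2']
    refine ⟨fun x y => ?_, key _ hA1 hB1, key _ hA2 hB2, key _ hA3 hB3⟩
    simp only [LieRing.of_associative_ring_bracket, LinearMap.sub_apply, Module.End.mul_apply,
      inner_sub_left, inner_sub_right]
    linarith [hA (B x) y, hB (A x) y, hA x (B y), hB x (A y)]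

/-- The space of hyper-Kähler curvature-type tensors on `V`. -/
def curvSpace : Submodule ℝ (Tensor4 V) where
  carrier := {K | (∀ x y z w, K y x z w = -K x y z w) ∧ (∀ x y z w, K x y w z = -K x y z w) ∧
    (∀ x y z w, K x y z w + K y z x w + K z x y w = 0) ∧
    (∀ x y z w, K x y (H.J₁ z) (H.J₁ w) = K x y z w) ∧
    (∀ x y z w, K x y (H.J₂ z) (H.J₂ w) = K x y z w) ∧
    (∀ x y z w, K x y (H.J₃ z) (H.J₃ w) = K x y z w)}
  add_mem' := by
    rintro K L ⟨hK1, hK2, hK3, hK4, hK5, hK6⟩ ⟨hL1, hL2, hL3, hL4, hL5, hL6⟩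
    refine ⟨fun x y z w => ?_, fun x y z w => ?_, fun x y z w => ?_, fun x y z w => ?_,
      fun x y z w => ?_, fun x y z w => ?_⟩ <;> simp only [LinearMap.add_apply]
    · rw [hK1, hL1]; ring
    · rw [hK2, hL2]; ring
    · linarith [hK3 x y z w, hL3 x y z w]
    · rw [hK4, hL4]
    · rw [hK5, hL5]
    · rw [hK6, hL6]
  zero_mem' := by simp
  smul_mem' := by
    rintro c K ⟨hK1, hK2, hK3, hK4, hK5, hK6⟩
    refine ⟨fun x y z w => ?_, fun x y z w => ?_, fun x y z w => ?_, fun x y z w => ?_,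
      fun x y z w => ?_, fun x y z w => ?_⟩ <;> simp only [LinearMap.smul_apply, smul_eq_mul]
    · rw [hK1]; ring
    · rw [hK2]; ring
    · rw [← mul_add, ← mul_add, hK3, mul_zero]
    · rw [hK4]
    · rw [hK5]
    · rw [hK6]

/-- Pair symmetry of curvature-type tensors. -/
theorem curvSpace_pair_symm {K : Tensor4 V} (hK : K ∈ H.curvSpace) (x y z w : V) :
    K x y z w = K z w x y := by
  obtain ⟨h1, h2, h3, -⟩ := hK
  linarith [h3 x y z w, h3 y z w x, h3 z w x y, h3 w x y z,
    h1 x y z w, h2 x y z w, h1 y z x w, h2 y z x w, h1 z x y w, h2 z x y w,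
    h1 z w x y, h2 z w x y, h1 w y z x, h2 w y z x, h1 x w y z, h2 x w y z,
    h1 y z w x, h1 z w y x, h2 z w y x, h2 w y x z, h1 y w x z, h1 w x z y, h2 w x z y,
    h1 x z w y, h2 x z w y, h2 x z y w, h1 x y w z, h2 x y w z, h1 y w z x, h2 y w z x]

/-! ### The operator `T_K` on `sp(n)` -/

section CurvatureOperator

theorem sum_orthonormalBasis_eq {ι κ : Type*} [Fintype ι] [Fintype κ]
    (h : OrthonormalBasis ι ℝ V) (k : OrthonormalBasis κ ℝ V) (F : V →ₗ[ℝ] V →ₗ[ℝ] ℝ) :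
    ∑ a, F (h a) (h a) = ∑ b, F (k b) (k b) := by
  classical
  have key : ∀ v, F v v = ∑ b, ∑ c, (⟪v, k b⟫_ℝ * ⟪k c, v⟫_ℝ) * F (k b) (k c) := by
    intro v
    conv_lhs => rw [← k.sum_repr' v]
    simp only [map_sum, map_smul, LinearMap.sum_apply, LinearMap.smul_apply, smul_eq_mul]
    simp only [Finset.mul_sum]
    rw [Finset.sum_comm]
    refine Finset.sum_congr rfl fun b _ => Finset.sum_congr rfl fun c _ => ?_
    rw [real_inner_comm (k b) v]; ring
  simp only [key (h _)]
  rw [Finset.sum_comm]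
  refine Finset.sum_congr rfl fun b _ => ?_
  rw [Finset.sum_comm]
  simp only [← Finset.sum_mul]
  have : ∀ c, ∑ a, ⟪h a, k b⟫_ℝ * ⟪k c, h a⟫_ℝ = if c = b then 1 else 0 := by
    intro c
    rw [← orthonormal_iff_ite.mp k.orthonormal c b, ← h.sum_inner_mul_inner (k c) (k b)]
    exact Finset.sum_congr rfl fun a _ => mul_comm _ _
  simp [this]

variable [FiniteDimensional ℝ V]

/-- For a 4-tensor `K` and an endomorphism `A` of `V`, the endomorphism `T` of `V` determined by
`g(T x, y) = ½ ∑ₐ K(x, y, hₐ, A hₐ)`, where `(hₐ)` is any orthonormal basis of `V`; see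
`inner_curvOpEnd`. -/
def curvOpEnd (K : Tensor4 V) : Module.End ℝ V →ₗ[ℝ] Module.End ℝ V :=
  LinearMap.mk₂ ℝ
    (fun A x => ∑ b, ((1 / 2 : ℝ) * ∑ a, K x (stdOrthonormalBasis ℝ V b)
      (stdOrthonormalBasis ℝ V a) (A (stdOrthonormalBasis ℝ V a))) • stdOrthonormalBasis ℝ V b)
    (fun A B x => by
      simp only [LinearMap.add_apply, map_add, Finset.sum_add_distrib, mul_add, add_smul])
    (fun c A x => by
      simp only [LinearMap.smul_apply, map_smul, smul_eq_mul, ← Finset.mul_sum, Finset.smul_sum,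
        smul_smul]
      exact Finset.sum_congr rfl fun b _ => by congr 1; ring)
    (fun A x y => by
      simp only [LinearMap.add_apply, map_add, Finset.sum_add_distrib, mul_add, add_smul])
    (fun c A x => by
      simp only [LinearMap.smul_apply, map_smul, smul_eq_mul, ← Finset.mul_sum, Finset.smul_sum,
        smul_smul]
      exact Finset.sum_congr rfl fun b _ => by congr 1; ring)

theorem inner_curvOpEnd (K : Tensor4 V) (A : Module.End ℝ V) {ι : Type*} [Fintype ι]
    (h : OrthonormalBasis ι ℝ V) (x y : V) :
    ⟪curvOpEnd K A x, y⟫_ℝ = (1 / 2 : ℝ) * ∑ a, K x y (h a) (A (h a)) := by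
  have e := sum_orthonormalBasis_eq (stdOrthonormalBasis ℝ V) h ((K x y).compl₂ A)
  simp only [LinearMap.compl₂_apply] at e
  rw [← e]
  conv_rhs => rw [← (stdOrthonormalBasis ℝ V).sum_repr' y]
  simp only [curvOpEnd, LinearMap.mk₂_apply, sum_inner, real_inner_smul_left, map_sum, map_smul,
    LinearMap.sum_apply, LinearMap.smul_apply, smul_eq_mul, Finset.mul_sum, Finset.sum_mul]
  rw [Finset.sum_comm]
  exact Finset.sum_congr rfl fun b _ => Finset.sum_congr rfl fun a _ => by ring

theorem curvOpEnd_mem {K : Tensor4 V} (hK : K ∈ H.curvSpace) (A : Module.End ℝ V) :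
    curvOpEnd K A ∈ H.sp := by
  have hs := H.curvSpace_pair_symm hK
  obtain ⟨h1, -, -, h4, h5, h6⟩ := hK
  have hi := inner_curvOpEnd K A (stdOrthonormalBasis ℝ V)
  have key : ∀ J : V →ₗ[ℝ] V, J ∘ₗ J = -LinearMap.id → (∀ x y, ⟪J x, J y⟫_ℝ = ⟪x, y⟫_ℝ) →
      (∀ x y z w, K x y (J z) (J w) = K x y z w) →
      curvOpEnd K A ∘ₗ J = J ∘ₗ curvOpEnd K A := by
    intro J hJ hg hKJ
    have hJJ : ∀ y, J (J y) = -y := fun y => LinearMap.congr_fun hJ y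
    have hinv : ∀ x y z w, K (J x) (J y) z w = K x y z w := by
      intro x y z w
      rw [hs, hKJ, hs]
    ext x
    refine ext_inner_right ℝ fun y => ?_
    have hy : y = J (-J y) := by rw [map_neg, hJJ, neg_neg]
    simp only [LinearMap.comp_apply]
    rw [hy, hg, hi, hi]
    simp only [hinv]
  refine ⟨fun x y => ?_, key _ H.J₁_sq H.J₁_isometry h4, key _ H.J₂_sq H.J₂_isometry h5,
    key _ H.J₃_sq H.J₃_isometry h6⟩
  rw [real_inner_comm _ x, hi, hi]
  simp only [h1 x y, Finset.sum_neg_distrib]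
  ring

/-- The operator `T_K` on `sp(n)`: `g(T_K(A) x, y) = ½ ∑ₐ K(x, y, hₐ, A hₐ)`. -/
def curvOp (K : H.curvSpace) : Module.End ℝ H.sp :=
  LinearMap.codRestrict H.sp.toSubmodule (curvOpEnd (K : Tensor4 V) ∘ₗ H.sp.toSubmodule.subtype)
    fun A => H.curvOpEnd_mem K.2 A

end CurvatureOperator

/-! ### The cubic discriminant -/

/-- The `i`-eigenspace of `J₁` in the complexification of `V`. -/
def W : Submodule ℂ (Complexify V) :=
  Module.End.eigenspace (endC H.J₁) Complex.I

/-- The antilinear map `j(x) = J₂ x̄` (used on `W`). -/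
def j (x : Complexify V) : Complexify V :=
  endC H.J₂ (conjC x)

/-- The complex 2-form `π` (used on `W`) with `g(x, y) = π(x, J₂ y)`, that is,
`π(x, y) = -g(x, J₂ y)`. -/
def pi (x y : Complexify V) : ℂ :=
  -bilinC (innerₗ V) x (endC H.J₂ y)

/-- An `Sp(2)`-adapted basis `e₁, e₂, e₃, e₄` of `W` (here indexed by `0, 1, 2, 3`): `e₃ = j(e₁)`,
`e₄ = j(e₂)` and `π = e¹ ∧ e³ + e² ∧ e⁴`. -/
structure IsAdapted (e : Module.Basis (Fin 4) ℂ H.W) : Prop where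
  j_zero : (e 2 : Complexify V) = H.j (e 0)
  j_one : (e 3 : Complexify V) = H.j (e 1)
  pi_eq : ∀ x y : H.W, H.pi x y =
    (e.repr x 0 * e.repr y 2 - e.repr x 2 * e.repr y 0) +
      (e.repr x 1 * e.repr y 3 - e.repr x 3 * e.repr y 1)

/-- The tensor `(x, y, z, w) ↦ K(x, f y, z, f w)`. -/
def comp24 (K : Tensor4 V) (f : V →ₗ[ℝ] V) : Tensor4 V :=
  LinearMap.compRight ℝ (LinearMap.compRight ℝ (LinearMap.compRight ℝ (LinearMap.lcomp ℝ ℝ f)) ∘ₗ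
    LinearMap.lcomp ℝ (V →ₗ[ℝ] V →ₗ[ℝ] ℝ) f) K

theorem comp24_apply (K : Tensor4 V) (f : V →ₗ[ℝ] V) (x y z w : V) :
    comp24 K f x y z w = K x (f y) z (f w) := rfl

/-- The totally symmetric tensor `S` corresponding to a hyper-Kähler curvature-type tensor `K`:
`S(x, y, z, w) = ½ (K(x, J₂ y, z, J₂ w) - K(x, J₃ y, z, J₃ w))`. -/
def symTensor (K : Tensor4 V) : Tensor4 V :=
  (1 / 2 : ℝ) • (comp24 K H.J₂ - comp24 K H.J₃)

theorem symTensor_apply (K : Tensor4 V) (x y z w : V) :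
    H.symTensor K x y z w = (1 / 2 : ℝ) * (K x (H.J₂ y) z (H.J₂ w) - K x (H.J₃ y) z (H.J₃ w)) :=
  rfl

/-- The discriminant quartic of a cubic polynomial, in the coordinates of an adapted basis. -/
def discQuartic (x : Fin 4 → ℂ) : ℂ :=
  -18 * x 0 * x 1 * x 2 * x 3 + 4 * (√3 : ℝ) * x 0 * x 3 ^ 3 - 4 * (√3 : ℝ) * x 1 ^ 3 * x 2
    + 3 * x 1 ^ 2 * x 3 ^ 2 - 9 * x 0 ^ 2 * x 2 ^ 2

/-- The orbit `𝒞` of the cubic discriminant: those `K` whose symmetric tensor `S` is given on `W`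
by the discriminant quartic with respect to some `Sp(2)`-adapted basis of `W`. -/
def cubicDiscriminants : Set H.curvSpace :=
  {K | ∃ e : Module.Basis (Fin 4) ℂ H.W, H.IsAdapted e ∧
    ∀ x : H.W, tensor4C (H.symTensor K) x x x x = discQuartic (e.repr x)}

end HyperHermitian

end CubicDiscriminant

end

noncomputable section

set_option maxSynthPendingDepth 3

set_option linter.unusedSimpArgs false

namespace CubicDiscriminant

namespace HyperHermitian

attribute [local instance 100] LieRing.ofAssociativeRing

section

variable {V : Type*} [NormedAddCommGroup V] [InnerProductSpace ℝ V] (H : HyperHermitian V)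

/-! ### Quaternionic relations -/

/-! Both sides are equivalent to a normal form. For some quaternionic orthonormal frame `u, v`, with
`A 0, A 1, A 2` the standard basis of the principal `su(2)` in `sp(2)` (acting on `W` as the cubics
`Sym³ ℂ²`), K(x,y,z,w) = ¼ ∑ g(Aᵢx,y) g(Aᵢz,w) − (3/2) g(P(z∧w)x,y), where P projects bivectors to
`sp(2)`. Since each Aᵢ has squared Frobenius norm 40, this says T_K = 5Π − 3/2, with Π the
orthogonal projection to that `su(2)`.

Operator side. Put Q = T_K + 3/2. Condition (II) rearranges to [QA, TB] = T[QA, B]: T commutes with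
ad of the image of Q, which under (I) is the 7/2-eigenspace 𝔥. So (I) and (II) hold for the normal
form. Conversely, (I) makes K a sum of squares over an orthonormal basis of 𝔥 plus a constant term,
the Bianchi identity forces dim 𝔥 = 3 (`card_eq_three`), and (II) makes 𝔥 a subalgebra. It is not
abelian (`pos_of_lie`), hence a copy of `su(2)`. Diagonalizing one generator with weights a ≥ b ≥ 0,
the bracket relations and Bianchi give a = 3b, the weights of the principal embedding
(`scalar_classification`).

Orbit side. K is determined by S, and S by its diagonal values (`eq_symTensor_add`,
`tensor4_eq_zero_of_diag`). For the normal form, S(x,x,x,x) on `W` is the sum of the squares of the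
three quadratic forms of the Aᵢ. These span the coefficients of the Hessian of the cubic, so the sum
is, up to scale, the discriminant of the Hessian, that is, the discriminant of the cubic
(`sum_symp_sq`). Adapted bases of `W` correspond to frames, whence `mem_cubicDiscriminants_iff`. -/

@[simp] theorem J₁_J₁ (x : V) : H.J₁ (H.J₁ x) = -x := LinearMap.congr_fun H.J₁_sq x

@[simp] theorem J₂_J₂ (x : V) : H.J₂ (H.J₂ x) = -x := LinearMap.congr_fun H.J₂_sq x

@[simp] theorem J₃_J₃ (x : V) : H.J₃ (H.J₃ x) = -x := LinearMap.congr_fun H.J₃_sq x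

@[simp] theorem J₁_J₂ (x : V) : H.J₁ (H.J₂ x) = H.J₃ x := LinearMap.congr_fun H.J₁_mul_J₂ x

@[simp] theorem J₂_J₁ (x : V) : H.J₂ (H.J₁ x) = -H.J₃ x := by
  rw [← LinearMap.congr_fun H.J₂_mul_J₁ x]; simp

@[simp] theorem J₁_J₃ (x : V) : H.J₁ (H.J₃ x) = -H.J₂ x := by
  rw [← H.J₁_J₂, H.J₁_J₁]

@[simp] theorem J₃_J₂ (x : V) : H.J₃ (H.J₂ x) = -H.J₁ x := by
  rw [← H.J₁_J₂, H.J₂_J₂, map_neg]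

@[simp] theorem J₂_J₃ (x : V) : H.J₂ (H.J₃ x) = H.J₁ x := by
  rw [← neg_neg (H.J₃ x), ← H.J₂_J₁, map_neg, H.J₂_J₂, neg_neg]

@[simp] theorem J₃_J₁ (x : V) : H.J₃ (H.J₁ x) = H.J₂ x := by
  rw [← H.J₁_J₂, H.J₂_J₁, map_neg, H.J₁_J₃, neg_neg]

@[simp] theorem inner_J₁_left (x y : V) : ⟪H.J₁ x, y⟫_ℝ = -⟪x, H.J₁ y⟫_ℝ := by
  rw [← H.J₁_isometry x, H.J₁_J₁, inner_neg_right, neg_neg]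

@[simp] theorem inner_J₂_left (x y : V) : ⟪H.J₂ x, y⟫_ℝ = -⟪x, H.J₂ y⟫_ℝ := by
  rw [← H.J₂_isometry x, H.J₂_J₂, inner_neg_right, neg_neg]

@[simp] theorem inner_J₃_left (x y : V) : ⟪H.J₃ x, y⟫_ℝ = -⟪x, H.J₃ y⟫_ℝ := by
  rw [← H.J₃_isometry x, H.J₃_J₃, inner_neg_right, neg_neg]

@[simp] theorem inner_J₁_self (x : V) : ⟪x, H.J₁ x⟫_ℝ = 0 := by
  linarith [H.inner_J₁_left x x, real_inner_comm x (H.J₁ x)]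

@[simp] theorem inner_J₂_self (x : V) : ⟪x, H.J₂ x⟫_ℝ = 0 := by
  linarith [H.inner_J₂_left x x, real_inner_comm x (H.J₂ x)]

@[simp] theorem inner_J₃_self (x : V) : ⟪x, H.J₃ x⟫_ℝ = 0 := by
  linarith [H.inner_J₃_left x x, real_inner_comm x (H.J₃ x)]

section

variable {H} {A : Module.End ℝ V} (hA : A ∈ H.sp)
include hA

theorem map_J₁_of_mem_sp (x : V) : A (H.J₁ x) = H.J₁ (A x) := LinearMap.congr_fun hA.2.1 x

theorem map_J₂_of_mem_sp (x : V) : A (H.J₂ x) = H.J₂ (A x) := LinearMap.congr_fun hA.2.2.1 x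

theorem map_J₃_of_mem_sp (x : V) : A (H.J₃ x) = H.J₃ (A x) := LinearMap.congr_fun hA.2.2.2 x

theorem inner_map_of_mem_sp (x y : V) : ⟪x, A y⟫_ℝ = -⟪A x, y⟫_ℝ := by
  linarith [hA.1 x y]

theorem inner_map_swap_of_mem_sp (x y : V) : ⟪A x, y⟫_ℝ = -⟪A y, x⟫_ℝ := by
  rw [real_inner_comm (A y) x |>.symm, inner_map_of_mem_sp hA, neg_neg]

theorem inner_map_J₁_swap_of_mem_sp (x y : V) : ⟪A x, H.J₁ y⟫_ℝ = ⟪A y, H.J₁ x⟫_ℝ := by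
  rw [← neg_eq_iff_eq_neg.mpr (H.inner_J₁_left (A x) y), ← map_J₁_of_mem_sp hA,
    inner_map_swap_of_mem_sp hA, neg_neg]

theorem inner_map_J₂_swap_of_mem_sp (x y : V) : ⟪A x, H.J₂ y⟫_ℝ = ⟪A y, H.J₂ x⟫_ℝ := by
  rw [← neg_eq_iff_eq_neg.mpr (H.inner_J₂_left (A x) y), ← map_J₂_of_mem_sp hA,
    inner_map_swap_of_mem_sp hA, neg_neg]

theorem inner_map_J₃_swap_of_mem_sp (x y : V) : ⟪A x, H.J₃ y⟫_ℝ = ⟪A y, H.J₃ x⟫_ℝ := by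
  rw [← neg_eq_iff_eq_neg.mpr (H.inner_J₃_left (A x) y), ← map_J₃_of_mem_sp hA,
    inner_map_swap_of_mem_sp hA, neg_neg]

end

/-! ### Quaternionic orthonormal frames -/

/-- `u, v` is an orthonormal basis of `V` over the quaternions. -/
structure IsFrame (u v : V) : Prop where
  uu : ⟪u, u⟫_ℝ = 1
  vv : ⟪v, v⟫_ℝ = 1
  uv : ⟪u, v⟫_ℝ = 0
  uJ₁v : ⟪u, H.J₁ v⟫_ℝ = 0
  uJ₂v : ⟪u, H.J₂ v⟫_ℝ = 0
  uJ₃v : ⟪u, H.J₃ v⟫_ℝ = 0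

namespace IsFrame

variable {H} {u v : V} (h : H.IsFrame u v)
include h

theorem vu : ⟪v, u⟫_ℝ = 0 := by rw [real_inner_comm, h.uv]

theorem vJ₁u : ⟪v, H.J₁ u⟫_ℝ = 0 := by rw [real_inner_comm, H.inner_J₁_left, h.uJ₁v, neg_zero]

theorem vJ₂u : ⟪v, H.J₂ u⟫_ℝ = 0 := by rw [real_inner_comm, H.inner_J₂_left, h.uJ₂v, neg_zero]

theorem vJ₃u : ⟪v, H.J₃ u⟫_ℝ = 0 := by rw [real_inner_comm, H.inner_J₃_left, h.uJ₃v, neg_zero]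

theorem swap : H.IsFrame v u := ⟨h.vv, h.uu, h.vu, h.vJ₁u, h.vJ₂u, h.vJ₃u⟩

/-- `J₂` anticommutes with `J₁`, so replacing `u` by `J₂ u` changes the sign of `a` in `A u = a • J₁
u`. -/
theorem map_J₂_left : H.IsFrame (H.J₂ u) v := by
  constructor <;> simp [-inner_self_eq_norm_sq_to_K, h.uu, h.vv, h.uv,
    h.uJ₁v, h.uJ₂v, h.uJ₃v]

theorem orthonormal : Orthonormal ℝ
    ![u, H.J₁ u, H.J₂ u, H.J₃ u, v, H.J₁ v, H.J₂ v, H.J₃ v] := by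
  rw [orthonormal_iff_ite]
  intro i j
  fin_cases i <;> fin_cases j <;>
    simp [-inner_self_eq_norm_sq_to_K, h.uu, h.vv, h.uv, h.uJ₁v, h.uJ₂v,
      h.uJ₃v, h.vu, h.vJ₁u, h.vJ₂u, h.vJ₃u]

variable (hV : Module.finrank ℝ V = 8)
include hV

theorem exists_orthonormalBasis : ∃ b : OrthonormalBasis (Fin 8) ℝ V,
    ⇑b = ![u, H.J₁ u, H.J₂ u, H.J₃ u, v, H.J₁ v, H.J₂ v, H.J₃ v] := by
  have hc : Fintype.card (Fin 8) = Module.finrank ℝ V := by simp [hV]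
  refine ⟨(basisOfOrthonormalOfCardEqFinrank h.orthonormal hc).toOrthonormalBasis ?_, ?_⟩
  · simpa using h.orthonormal
  · simp

theorem sum_eq (x : V) : x = ⟪x, u⟫_ℝ • u + ⟪x, H.J₁ u⟫_ℝ • H.J₁ u + ⟪x, H.J₂ u⟫_ℝ • H.J₂ u +
    ⟪x, H.J₃ u⟫_ℝ • H.J₃ u + ⟪x, v⟫_ℝ • v + ⟪x, H.J₁ v⟫_ℝ • H.J₁ v + ⟪x, H.J₂ v⟫_ℝ • H.J₂ v +
    ⟪x, H.J₃ v⟫_ℝ • H.J₃ v := by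
  obtain ⟨b, hb⟩ := h.exists_orthonormalBasis hV
  conv_lhs => rw [← b.sum_repr' x]
  simp only [hb, Fin.sum_univ_eight, real_inner_comm x]
  rfl

/-- Two elements of `sp(2)` agreeing on a frame are equal. -/
theorem ext_sp {A B : Module.End ℝ V} (hA : A ∈ H.sp) (hB : B ∈ H.sp) (hu : A u = B u)
    (hv : A v = B v) : A = B := by
  ext x
  rw [h.sum_eq hV x]
  simp only [map_add, map_smul, map_J₁_of_mem_sp hA, map_J₂_of_mem_sp hA, map_J₃_of_mem_sp hA,
    map_J₁_of_mem_sp hB, map_J₂_of_mem_sp hB, map_J₃_of_mem_sp hB, hu, hv]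

end IsFrame

/-! ### Simultaneous diagonalization -/

/-- A commuting family of symmetric operators has a joint unit eigenvector in every nontrivial
invariant subspace. -/
theorem exists_joint_eigenvector [FiniteDimensional ℝ V] {ι : Type*} {B : ι → Module.End ℝ V}
    (hB : ∀ i, (B i).IsSymmetric) (hC : ∀ i j, Commute (B i) (B j)) {U : Submodule ℝ V}
    (hU : U ≠ ⊥) (hBU : ∀ i, ∀ x ∈ U, B i x ∈ U) :
    ∃ x ∈ U, ⟪x, x⟫_ℝ = 1 ∧ ∀ i, ∃ a : ℝ, B i x = a • x := by
  have : Nontrivial U := Submodule.nontrivial_iff_ne_bot.mpr hU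
  let T : ι → Module.End ℝ U := fun i => (B i).restrict (hBU i)
  have hT : ∀ i, (T i).IsSymmetric := fun i x y => hB i x y
  have hTC : Pairwise (Function.onFun Commute T) := fun i j _ => by
    refine LinearMap.ext fun x => Subtype.ext ?_
    exact LinearMap.congr_fun (hC i j) (x : V)
  have htop := LinearMap.IsSymmetric.iSup_iInf_eq_top_of_commute hT hTC
  obtain ⟨χ, hχ⟩ : ∃ χ : ι → ℝ, (⨅ i, Module.End.eigenspace (T i) (χ i)) ≠ ⊥ := by
    by_contra! hcon
    simp only [hcon, iSup_bot] at htop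
    exact bot_ne_top htop
  obtain ⟨y, hy, hy0⟩ := Submodule.exists_mem_ne_zero_of_ne_bot hχ
  have hn : ‖(y : V)‖ ≠ 0 := by simpa using hy0
  refine ⟨‖(y : V)‖⁻¹ • (y : V), U.smul_mem _ y.2, ?_, fun i => ⟨χ i, ?_⟩⟩
  · rw [real_inner_smul_left, real_inner_smul_right, real_inner_self_eq_norm_sq]
    field_simp
  · have h1 := Module.End.mem_eigenspace_iff.mp ((Submodule.mem_iInf _).mp hy i)
    have h2 : B i (y : V) = χ i • (y : V) := congrArg Subtype.val h1
    rw [map_smul, h2, smul_comm]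

/-- Commuting elements of `sp(2)` are simultaneously diagonal in some frame. -/
theorem exists_frame_of_commute [FiniteDimensional ℝ V] (hV : Module.finrank ℝ V = 8)
    {ι : Type*} {A : ι → Module.End ℝ V} (hA : ∀ i, A i ∈ H.sp)
    (hC : ∀ i j, Commute (A i) (A j)) :
    ∃ u v, H.IsFrame u v ∧ ∀ i, (∃ a : ℝ, A i u = a • H.J₁ u) ∧ ∃ b : ℝ, A i v = b • H.J₁ v := by
  -- Composing with `J₁` turns the skew `A i` into symmetric operators that still commute, so the
  -- real spectral theorem applies.
  let B : ι → Module.End ℝ V := fun i => H.J₁ ∘ₗ A i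
  have hB : ∀ i, (B i).IsSymmetric := fun i x y => by
    change ⟪H.J₁ (A i x), y⟫_ℝ = ⟪x, H.J₁ (A i y)⟫_ℝ
    rw [H.inner_J₁_left, ← map_J₁_of_mem_sp (hA i), inner_map_of_mem_sp (hA i)]
  have hBC : ∀ i j, Commute (B i) (B j) := fun i j => by
    refine LinearMap.ext fun x => ?_
    have := LinearMap.congr_fun (hC i j) x
    simp only [Module.End.mul_apply] at this
    simp [B, map_J₁_of_mem_sp (hA _), this]
  have hBe : ∀ i x (a : ℝ), B i x = a • x → A i x = (-a) • H.J₁ x := fun i x a h => by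
    have := congrArg H.J₁ h
    simp only [B, LinearMap.comp_apply, J₁_J₁, map_smul] at this
    rw [neg_smul, ← this, neg_neg]
  have hpos : 0 < Module.finrank ℝ V := by omega
  have : Nontrivial V := Module.nontrivial_of_finrank_pos hpos
  obtain ⟨u, -, huu, hu⟩ := exists_joint_eigenvector hB hBC (U := ⊤) top_ne_bot (by simp)
  -- The quaternionic line of `u`. Its orthogonal complement is nonzero by dimension and invariant
  -- because the `A i` commute with all three `J`s.
  let S : Submodule ℝ V := Submodule.span ℝ (Set.range ![u, H.J₁ u, H.J₂ u, H.J₃ u])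
  have hS : Sᗮ ≠ ⊥ := by
    intro h0
    have h1 := S.finrank_add_finrank_orthogonal
    have h2 : Module.finrank ℝ S ≤ 4 := by
      exact (finrank_range_le_card (R := ℝ) ![u, H.J₁ u, H.J₂ u, H.J₃ u]).trans (by simp)
    rw [h0, finrank_bot] at h1
    omega
  have hSm : ∀ x, x ∈ Sᗮ ↔ ⟪u, x⟫_ℝ = 0 ∧ ⟪u, H.J₁ x⟫_ℝ = 0 ∧ ⟪u, H.J₂ x⟫_ℝ = 0 ∧
      ⟪u, H.J₃ x⟫_ℝ = 0 := fun x => by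
    have : x ∈ Sᗮ ↔ ∀ i, ⟪![u, H.J₁ u, H.J₂ u, H.J₃ u] i, x⟫_ℝ = 0 := by
      constructor
      · intro hx i
        exact hx _ (Submodule.subset_span ⟨i, rfl⟩)
      · intro hx y hy
        induction hy using Submodule.span_induction with
        | mem y hy => obtain ⟨i, rfl⟩ := hy; exact hx i
        | zero => simp
        | add y z _ _ h1 h2 => rw [inner_add_left, h1, h2, add_zero]
        | smul c y _ h1 => rw [real_inner_smul_left, h1, mul_zero]
    rw [this, Fin.forall_fin_succ, Fin.forall_fin_succ, Fin.forall_fin_two]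
    simp
  obtain ⟨v, hvS, hvv, hv⟩ := exists_joint_eigenvector hB hBC hS (by
    intro i x hx
    obtain ⟨a, ha⟩ := hu i
    have hau := hBe i u a ha
    rw [hSm] at hx ⊢
    simp [B, inner_map_of_mem_sp (hA i), hau, ← map_J₁_of_mem_sp (hA i), ← map_J₂_of_mem_sp (hA i),
      ← map_J₃_of_mem_sp (hA i), real_inner_smul_left, hx])
  rw [hSm] at hvS
  refine ⟨u, v, ⟨huu, hvv, hvS.1, hvS.2.1, hvS.2.2.1, hvS.2.2.2⟩, fun i => ?_⟩
  obtain ⟨a, ha⟩ := hu i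
  obtain ⟨b, hb⟩ := hv i
  exact ⟨⟨_, hBe i u a ha⟩, ⟨_, hBe i v b hb⟩⟩

end

section

variable {V : Type*} [NormedAddCommGroup V] [InnerProductSpace ℝ V] (H : HyperHermitian V)

/-! ### Projecting bivectors to `sp(2)` -/

/-- The skew endomorphism `x ↦ g(z, x) w - g(w, x) z`. -/
def wedge (z w : V) : Module.End ℝ V :=
  (innerₗ V z).smulRight w - (innerₗ V w).smulRight z

@[simp] theorem wedge_apply (z w x : V) : wedge z w x = ⟪z, x⟫_ℝ • w - ⟪w, x⟫_ℝ • z := rfl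

/-- The projection of `wedge z w` to `sp(2)`. -/
def spWedge (z w : V) : Module.End ℝ V :=
  (1 / 4 : ℝ) • (wedge z w + wedge (H.J₁ z) (H.J₁ w) + wedge (H.J₂ z) (H.J₂ w) +
    wedge (H.J₃ z) (H.J₃ w))

theorem spWedge_apply (z w x : V) : H.spWedge z w x = (1 / 4 : ℝ) •
    ((⟪z, x⟫_ℝ • w - ⟪w, x⟫_ℝ • z) + (⟪H.J₁ z, x⟫_ℝ • H.J₁ w - ⟪H.J₁ w, x⟫_ℝ • H.J₁ z) +
    (⟪H.J₂ z, x⟫_ℝ • H.J₂ w - ⟪H.J₂ w, x⟫_ℝ • H.J₂ z) +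
    (⟪H.J₃ z, x⟫_ℝ • H.J₃ w - ⟪H.J₃ w, x⟫_ℝ • H.J₃ z)) := rfl

theorem spWedge_mem (z w : V) : H.spWedge z w ∈ H.sp := by
  refine ⟨fun x y => ?_, LinearMap.ext fun x => ?_, LinearMap.ext fun x => ?_,
    LinearMap.ext fun x => ?_⟩
  · simp only [spWedge_apply, inner_add_left, inner_add_right, inner_sub_left, inner_sub_right,
      real_inner_smul_left, real_inner_smul_right, real_inner_comm x]
    ring
  all_goals
    simp only [LinearMap.comp_apply, spWedge_apply, map_smul, map_add, map_sub, inner_J₁_left,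
      inner_J₂_left, inner_J₃_left, J₁_J₁, J₁_J₂, J₁_J₃, J₂_J₁, J₂_J₂, J₂_J₃, J₃_J₁, J₃_J₂, J₃_J₃,
      inner_neg_right]
    module

/-- Pair symmetry of the constant-curvature term, i.e. self-adjointness of the projection of
bivectors to `sp(2)`. -/
theorem inner_spWedge_swap (x y z w : V) :
    ⟪H.spWedge z w x, y⟫_ℝ = ⟪H.spWedge x y z, w⟫_ℝ := by
  simp only [spWedge_apply, inner_add_left, inner_sub_left, real_inner_smul_left, inner_J₁_left,
    inner_J₂_left, inner_J₃_left, real_inner_comm _ x, real_inner_comm _ y]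
  ring

/-! ### The ad-invariant inner product on `sp(2)`. -/

section

variable [FiniteDimensional ℝ V]

/-- The Frobenius inner product on endomorphisms. -/
def frob : Module.End ℝ V →ₗ[ℝ] Module.End ℝ V →ₗ[ℝ] ℝ :=
  ∑ a, (innerₗ V).compl₁₂ (LinearMap.applyₗ (stdOrthonormalBasis ℝ V a))
    (LinearMap.applyₗ (stdOrthonormalBasis ℝ V a))

theorem frob_apply {ι : Type*} [Fintype ι] (b : OrthonormalBasis ι ℝ V) (A B : Module.End ℝ V) :
    frob A B = ∑ a, ⟪A (b a), B (b a)⟫_ℝ := by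
  have := sum_orthonormalBasis_eq (stdOrthonormalBasis ℝ V) b ((innerₗ V).compl₁₂ A B)
  simpa [frob] using this

theorem frob_comm (A B : Module.End ℝ V) : frob A B = frob B A := by
  simp only [frob_apply (stdOrthonormalBasis ℝ V), real_inner_comm]

theorem frob_wedge (A : Module.End ℝ V) (z w : V) :
    frob A (wedge z w) = ⟪A z, w⟫_ℝ - ⟪A w, z⟫_ℝ := by
  have key : ∀ z w : V, ⟪A z, w⟫_ℝ = ∑ a, ⟪z, stdOrthonormalBasis ℝ V a⟫_ℝ *
      ⟪A (stdOrthonormalBasis ℝ V a), w⟫_ℝ := by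
    intro z w
    conv_lhs => rw [← (stdOrthonormalBasis ℝ V).sum_repr' z]
    simp only [map_sum, map_smul, sum_inner, real_inner_smul_left, real_inner_comm z]
  rw [frob_apply (stdOrthonormalBasis ℝ V), key z w, key w z, ← Finset.sum_sub_distrib]
  simp [inner_sub_right, real_inner_smul_right]

/-- Against an element of `sp(2)` all four summands of `spWedge` pair equally, so the projection may
be replaced by `wedge z w` itself. -/
theorem frob_spWedge {A : Module.End ℝ V} (hA : A ∈ H.sp) (z w : V) :
    frob A (H.spWedge z w) = 2 * ⟪A z, w⟫_ℝ := by
  simp only [spWedge, map_smul, map_add, frob_wedge, map_J₁_of_mem_sp hA, map_J₂_of_mem_sp hA,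
    map_J₃_of_mem_sp hA, H.J₁_isometry, H.J₂_isometry, H.J₃_isometry, smul_eq_mul,
    inner_map_swap_of_mem_sp hA w z]
  ring

/-- Invariance of the trace form under ad of a skew `A`. It makes structure constants in an
orthonormal basis totally antisymmetric. -/
theorem frob_lie {H : HyperHermitian V} {A B : Module.End ℝ V} (hA : A ∈ H.sp) (C : Module.End ℝ V) :
    frob (A * B - B * A) C = frob B (C * A - A * C) := by
  have h1 : frob (A * B) C = - frob B (A * C) := by
    simp only [frob_apply (stdOrthonormalBasis ℝ V), Module.End.mul_apply,
      inner_map_of_mem_sp hA, Finset.sum_neg_distrib, neg_neg]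
  have h2 : frob (B * A) C = - frob B (C * A) := by
    -- Contracting a bilinear form with a skew matrix changes sign when the matrix moves to the
    -- other slot.
    have key : ∀ F : V →ₗ[ℝ] V →ₗ[ℝ] ℝ, ∑ a, F (A (stdOrthonormalBasis ℝ V a))
        (stdOrthonormalBasis ℝ V a) = - ∑ a, F (stdOrthonormalBasis ℝ V a)
        (A (stdOrthonormalBasis ℝ V a)) := by
      intro F
      have e1 : ∀ a, A (stdOrthonormalBasis ℝ V a) = ∑ b, ⟪stdOrthonormalBasis ℝ V b,
          A (stdOrthonormalBasis ℝ V a)⟫_ℝ • stdOrthonormalBasis ℝ V b := fun a =>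
        ((stdOrthonormalBasis ℝ V).sum_repr' _).symm
      have e2 : ∀ a, F (A (stdOrthonormalBasis ℝ V a)) (stdOrthonormalBasis ℝ V a) =
          ∑ b, ⟪stdOrthonormalBasis ℝ V b, A (stdOrthonormalBasis ℝ V a)⟫_ℝ *
            F (stdOrthonormalBasis ℝ V b) (stdOrthonormalBasis ℝ V a) := fun a => by
        conv_lhs => rw [e1 a]
        simp
      have e3 : ∀ a, F (stdOrthonormalBasis ℝ V a) (A (stdOrthonormalBasis ℝ V a)) =
          ∑ b, ⟪stdOrthonormalBasis ℝ V b, A (stdOrthonormalBasis ℝ V a)⟫_ℝ *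
            F (stdOrthonormalBasis ℝ V a) (stdOrthonormalBasis ℝ V b) := fun a => by
        conv_lhs => rw [e1 a]
        simp
      simp only [e2, e3]
      rw [Finset.sum_comm, ← Finset.sum_neg_distrib]
      refine Finset.sum_congr rfl fun a _ => ?_
      rw [← Finset.sum_neg_distrib]
      refine Finset.sum_congr rfl fun b _ => ?_
      rw [inner_map_of_mem_sp hA, real_inner_comm]
      ring
    simpa [frob_apply (stdOrthonormalBasis ℝ V)] using key ((innerₗ V).compl₁₂ B C)
  rw [map_sub, LinearMap.sub_apply, h1, h2, map_sub]
  ring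

/-- On `sp(2)` the Frobenius inner product is computed on a frame. -/
theorem IsFrame.frob_eq {H : HyperHermitian V} (hV : Module.finrank ℝ V = 8) {u v : V}
    (h : H.IsFrame u v) {A B : Module.End ℝ V} (hA : A ∈ H.sp) (hB : B ∈ H.sp) :
    frob A B = 4 * (⟪A u, B u⟫_ℝ + ⟪A v, B v⟫_ℝ) := by
  obtain ⟨b, hb⟩ := h.exists_orthonormalBasis hV
  rw [frob_apply b, Fin.sum_univ_eight]
  simp [hb, map_J₁_of_mem_sp hA, map_J₂_of_mem_sp hA, map_J₃_of_mem_sp hA,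
    map_J₁_of_mem_sp hB, map_J₂_of_mem_sp hB, map_J₃_of_mem_sp hB]
  ring

/-! ### The curvature operator and the curvature tensor -/

variable {H}

theorem inner_curvOpEnd_wedge {K : Tensor4 V} (hK : K ∈ H.curvSpace) (x y z w : V) :
    ⟪curvOpEnd K (wedge z w) x, y⟫_ℝ = K x y z w := by
  have key : ∀ z w : V, K x y z w = ∑ a, ⟪z, stdOrthonormalBasis ℝ V a⟫_ℝ *
      K x y (stdOrthonormalBasis ℝ V a) w := by
    intro z w
    conv_lhs => rw [← (stdOrthonormalBasis ℝ V).sum_repr' z]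
    simp only [map_sum, map_smul, LinearMap.sum_apply, LinearMap.smul_apply, smul_eq_mul,
      real_inner_comm z]
  rw [inner_curvOpEnd K _ (stdOrthonormalBasis ℝ V)]
  simp only [wedge_apply, map_sub, map_smul, smul_eq_mul, Finset.sum_sub_distrib]
  rw [← key z w, ← key w z, hK.2.1]
  ring

/-- The `J`-invariance of `K` in its last pair lets the curvature operator factor through the
projection to `sp(2)`. Hence T_K on `sp(2)` determines `K`. -/
theorem inner_curvOpEnd_spWedge {K : Tensor4 V} (hK : K ∈ H.curvSpace) (x y z w : V) :
    ⟪curvOpEnd K (H.spWedge z w) x, y⟫_ℝ = K x y z w := by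
  simp only [spWedge, map_smul, map_add, LinearMap.smul_apply, LinearMap.add_apply,
    real_inner_smul_left, inner_add_left, inner_curvOpEnd_wedge hK]
  obtain ⟨-, -, -, h4, h5, h6⟩ := hK
  rw [h4, h5, h6]
  ring

/-- Self-adjointness of T_K, a consequence of pair symmetry. -/
theorem frob_curvOpEnd {K : Tensor4 V} (hK : K ∈ H.curvSpace) (A B : Module.End ℝ V) :
    frob (curvOpEnd K A) B = frob A (curvOpEnd K B) := by
  rw [frob_comm A]
  simp only [frob_apply (stdOrthonormalBasis ℝ V)]
  simp only [inner_curvOpEnd K _ (stdOrthonormalBasis ℝ V), Finset.mul_sum]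
  rw [Finset.sum_comm]
  refine Finset.sum_congr rfl fun a _ => Finset.sum_congr rfl fun b _ => ?_
  rw [H.curvSpace_pair_symm hK]

/-- Translates the shape of `K` into operator form: squares become rank-one operators, and the
`spWedge` term contracts to a multiple of the identity because `frob B (spWedge x y)` is `2 g(Bx,
y)`. -/
theorem curvOpEnd_eq_of_model {K : Tensor4 V} {ι : Type*} [Fintype ι] {c : ℝ}
    {A : ι → Module.End ℝ V}
    (hK : ∀ x y z w, K x y z w = c * ∑ i, ⟪A i x, y⟫_ℝ * ⟪A i z, w⟫_ℝ -
      (3 / 2) * ⟪H.spWedge z w x, y⟫_ℝ) {B : Module.End ℝ V} (hB : B ∈ H.sp) :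
    curvOpEnd K B = (c / 2) • ∑ i, frob (A i) B • A i - (3 / 2 : ℝ) • B := by
  refine LinearMap.ext fun x => ext_inner_right ℝ fun y => ?_
  have h1 : ∑ a, ⟪H.spWedge x y (stdOrthonormalBasis ℝ V a), B (stdOrthonormalBasis ℝ V a)⟫_ℝ =
      2 * ⟪B x, y⟫_ℝ := by
    rw [← frob_apply, frob_comm, H.frob_spWedge hB]
  rw [inner_curvOpEnd K B (stdOrthonormalBasis ℝ V)]
  simp only [hK, H.inner_spWedge_swap x y, Finset.sum_sub_distrib, ← Finset.mul_sum, h1]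
  rw [Finset.sum_comm]
  simp only [← Finset.mul_sum, ← frob_apply, LinearMap.sub_apply, LinearMap.smul_apply,
    LinearMap.sum_apply, inner_sub_left, real_inner_smul_left, sum_inner]
  simp only [mul_comm ⟪A _ x, y⟫_ℝ]
  ring

end

end

section

variable {V : Type*} [NormedAddCommGroup V] [InnerProductSpace ℝ V] (H : HyperHermitian V)

/-! ### Principal triples -/

/-- `A 0, A 1, A 2` span the principal `su(2)` in `sp(2)`, in its standard form with respect to the
frame `u, v`. -/
structure IsPrincipal (u v : V) (A : Fin 3 → Module.End ℝ V) : Prop where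
  mem : ∀ i, A i ∈ H.sp
  zero_u : A 0 u = (3 : ℝ) • H.J₁ u
  zero_v : A 0 v = H.J₁ v
  one_u : A 1 u = -√3 • v
  one_v : A 1 v = √3 • u + (2 : ℝ) • H.J₂ v
  two_u : A 2 u = √3 • H.J₁ v
  two_v : A 2 v = √3 • H.J₁ u - (2 : ℝ) • H.J₃ v

variable {H}

theorem IsFrame.exists_isPrincipal {u v : V} (h : H.IsFrame u v) :
    ∃ A, H.IsPrincipal u v A := by
  have hs : ∀ (a b : ℝ) (x y z w : V), a • H.spWedge x y + b • H.spWedge z w ∈ H.sp :=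
    fun a b x y z w => add_mem (H.sp.smul_mem a (H.spWedge_mem x y))
      (H.sp.smul_mem b (H.spWedge_mem z w))
  -- The coefficients follow from `spWedge u (J₁ u)` sending `u` to `½ J₁ u` and killing `v`, while
  -- `spWedge u v` sends `u` to `¼ v`.
  refine ⟨![(6 : ℝ) • H.spWedge u (H.J₁ u) + (2 : ℝ) • H.spWedge v (H.J₁ v),
    (-(4 * √3)) • H.spWedge u v + (4 : ℝ) • H.spWedge v (H.J₂ v),
    (4 * √3) • H.spWedge u (H.J₁ v) + (-4 : ℝ) • H.spWedge v (H.J₃ v)], ?_, ?_, ?_, ?_, ?_, ?_, ?_⟩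
  · intro i
    fin_cases i <;> exact hs _ _ _ _ _ _
  all_goals
    simp [-inner_self_eq_norm_sq_to_K, spWedge_apply, h.uu, h.vv, h.uv, h.uJ₁v, h.uJ₂v, h.uJ₃v,
      h.vu, h.vJ₁u, h.vJ₂u, h.vJ₃u]
    try module

namespace IsPrincipal

variable {u v : V} {A : Fin 3 → Module.End ℝ V} (hA : H.IsPrincipal u v A) (h : H.IsFrame u v)
  (hV : Module.finrank ℝ V = 8)
include hA h hV

theorem lie_zero_one : A 0 * A 1 - A 1 * A 0 = (2 : ℝ) • A 2 := by
  refine h.ext_sp hV (H.sp.lie_mem (hA.mem 0) (hA.mem 1)) (H.sp.smul_mem _ (hA.mem 2)) ?_ ?_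
  all_goals
    simp [hA.zero_u, hA.zero_v, hA.one_u, hA.one_v, hA.two_u, hA.two_v,
      map_J₁_of_mem_sp (hA.mem _), map_J₂_of_mem_sp (hA.mem _), map_J₃_of_mem_sp (hA.mem _)]
    module

theorem lie_one_two : A 1 * A 2 - A 2 * A 1 = (2 : ℝ) • A 0 := by
  have h3 : √3 * √3 = (3 : ℝ) := Real.mul_self_sqrt (by norm_num)
  refine h.ext_sp hV (H.sp.lie_mem (hA.mem 1) (hA.mem 2)) (H.sp.smul_mem _ (hA.mem 0)) ?_ ?_
  all_goals
    simp [hA.zero_u, hA.zero_v, hA.one_u, hA.one_v, hA.two_u, hA.two_v,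
      map_J₁_of_mem_sp (hA.mem _), map_J₂_of_mem_sp (hA.mem _), map_J₃_of_mem_sp (hA.mem _),
      smul_smul, h3]
    match_scalars <;> linarith

theorem lie_two_zero : A 2 * A 0 - A 0 * A 2 = (2 : ℝ) • A 1 := by
  refine h.ext_sp hV (H.sp.lie_mem (hA.mem 2) (hA.mem 0)) (H.sp.smul_mem _ (hA.mem 1)) ?_ ?_
  all_goals
    simp [hA.zero_u, hA.zero_v, hA.one_u, hA.one_v, hA.two_u, hA.two_v,
      map_J₁_of_mem_sp (hA.mem _), map_J₂_of_mem_sp (hA.mem _), map_J₃_of_mem_sp (hA.mem _)]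
    module

theorem frob_eq [FiniteDimensional ℝ V] (i j : Fin 3) :
    frob (A i) (A j) = if i = j then 40 else 0 := by
  have h3 : √3 * √3 = (3 : ℝ) := Real.mul_self_sqrt (by norm_num)
  rw [h.frob_eq hV (hA.mem i) (hA.mem j)]
  fin_cases i <;> fin_cases j <;>
    simp [-inner_self_eq_norm_sq_to_K, inner_add_left, inner_add_right, inner_sub_left,
      inner_sub_right, real_inner_smul_left, real_inner_smul_right,
      hA.zero_u, hA.zero_v, hA.one_u, hA.one_v, hA.two_u, hA.two_v, h3,
      h.uu, h.vv, h.uv, h.uJ₁v, h.uJ₂v, h.uJ₃v, h.vu, h.vJ₁u, h.vJ₂u, h.vJ₃u] <;> norm_num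

/-- The algebraic conditions characterizing the orbit of the cubic discriminant hold for the model
curvature tensor of a principal triple. -/
theorem curvOp_conditions [FiniteDimensional ℝ V] (K : H.curvSpace)
    (hK : ∀ x y z w, (K : Tensor4 V) x y z w = (1 / 4 : ℝ) * ∑ i, ⟪A i x, y⟫_ℝ * ⟪A i z, w⟫_ℝ -
      (3 / 2) * ⟪H.spWedge z w x, y⟫_ℝ) :
    ((2 : ℝ) • H.curvOp K - (7 : ℝ) • LinearMap.id) ∘ₗ
        ((2 : ℝ) • H.curvOp K + (3 : ℝ) • LinearMap.id) = 0 ∧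
      ∀ A B : H.sp, ⁅H.curvOp K A, H.curvOp K B⁆ - H.curvOp K ⁅H.curvOp K A, B⁆ =
        (3 / 2 : ℝ) • (H.curvOp K ⁅A, B⁆ - ⁅A, H.curvOp K B⁆) := by
  -- By `frob_eq` the operator is `40/8 - 3/2 = 7/2` on the triple and `-3/2` on its orthogonal
  -- complement.
  have hT : ∀ B : H.sp, (H.curvOp K B : Module.End ℝ V) =
      (1 / 8 : ℝ) • (frob (A 0) B • A 0 + frob (A 1) B • A 1 + frob (A 2) B • A 2) -
        (3 / 2 : ℝ) • (B : Module.End ℝ V) := fun B => by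
    have := curvOpEnd_eq_of_model hK B.2
    rw [Fin.sum_univ_three] at this
    refine Eq.trans this ?_
    norm_num
  constructor
  · refine LinearMap.ext fun B => Subtype.ext ?_
    simp [hT, hA.frob_eq h hV]
    module
  · intro B C
    refine Subtype.ext ?_
    have l01 := sub_eq_iff_eq_add.mp (hA.lie_zero_one h hV)
    have l12 := sub_eq_iff_eq_add.mp (hA.lie_one_two h hV)
    have l20 := sub_eq_iff_eq_add.mp (hA.lie_two_zero h hV)
    -- Invariance of `frob` trades the two orders of a product for a bracket inside the triple, so
    -- that both sides of (II) reduce to the same combination.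
    have f : ∀ i j, frob (A i) (A j * (C : Module.End ℝ V)) =
        frob (A i) ((C : Module.End ℝ V) * A j) - frob (A j * A i - A i * A j) C := fun i j => by
      rw [frob_lie (hA.mem j), map_sub]
      ring
    simp only [AddSubgroupClass.coe_sub, SetLike.val_smul, LieSubalgebra.coe_bracket, hT,
      LieRing.of_associative_ring_bracket, mul_add, add_mul, mul_sub, sub_mul, smul_mul_assoc,
      mul_smul_comm, map_add, map_sub, map_smul, smul_eq_mul, f, l01, l12, l20,
      LinearMap.add_apply, LinearMap.sub_apply, LinearMap.smul_apply]
    module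

end IsPrincipal

end

section

variable {V : Type*} [NormedAddCommGroup V] [InnerProductSpace ℝ V] {H : HyperHermitian V}

/-! ### The eigenspace of the curvature operator -/

/-- Evaluation on an orthonormal basis embeds `sp(2)` isometrically into a Euclidean sum of copies
of `V`, from which an orthonormal basis of the image of `S` is pulled back. -/
theorem exists_frob_orthonormal_basis [FiniteDimensional ℝ V] (S : Submodule ℝ H.sp) :
    ∃ (n : ℕ) (A : Fin n → H.sp), (∀ i, A i ∈ S) ∧
      (∀ i j, frob (A i : Module.End ℝ V) (A j) = if i = j then 1 else 0) ∧
      ∀ B ∈ S, (B : Module.End ℝ V) = ∑ i, frob (A i : Module.End ℝ V) B • (A i : Module.End ℝ V) := by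
  let b := stdOrthonormalBasis ℝ V
  let Φ : H.sp →ₗ[ℝ] PiLp 2 (fun _ : Fin (Module.finrank ℝ V) => V) :=
    (WithLp.linearEquiv 2 ℝ (Fin (Module.finrank ℝ V) → V)).symm.toLinearMap ∘ₗ
      LinearMap.pi fun a => LinearMap.applyₗ (b a) ∘ₗ H.sp.toSubmodule.subtype
  have hΦ : ∀ A B : H.sp, ⟪Φ A, Φ B⟫_ℝ = frob (A : Module.End ℝ V) B := fun A B => by
    rw [frob_apply b, PiLp.inner_apply]
    rfl
  have hinj : Function.Injective Φ := by
    refine (injective_iff_map_eq_zero Φ).mpr fun A hA => Subtype.ext ?_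
    refine b.toBasis.ext fun a => ?_
    have := congrArg (fun f => f a) hA
    exact this
  let e := stdOrthonormalBasis ℝ (S.map Φ)
  have hex : ∀ i, ∃ A ∈ S, Φ A = (e i : PiLp 2 (fun _ : Fin (Module.finrank ℝ V) => V)) :=
    fun i => (Submodule.mem_map).mp (e i).2
  choose A hAS hAe using hex
  refine ⟨_, A, hAS, fun i j => ?_, fun B hB => ?_⟩
  · rw [← hΦ, hAe, hAe, ← orthonormal_iff_ite.mp e.orthonormal i j]
    rfl
  · have h1 : (⟨Φ B, Submodule.mem_map_of_mem hB⟩ : S.map Φ) = ∑ i, frob (A i : Module.End ℝ V) B • e i := by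
      rw [← e.sum_repr' ⟨Φ B, Submodule.mem_map_of_mem hB⟩]
      refine Finset.sum_congr rfl fun i _ => ?_
      rw [← hΦ, hAe]
      rfl
    have h2 : Φ B = Φ (∑ i, frob (A i : Module.End ℝ V) B • A i) := by
      have := congrArg Subtype.val h1
      simpa [hAe] using this
    have h3 := congrArg Subtype.val (hinj h2)
    simpa using h3

/-- Under the quadratic equation for the curvature operator, the curvature tensor is a sum of squares
of an orthonormal basis of the `7/2`-eigenspace up to a constant curvature term. -/
theorem exists_model_of_quadratic [FiniteDimensional ℝ V] {K : H.curvSpace}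
    (hK : ((2 : ℝ) • H.curvOp K - (7 : ℝ) • LinearMap.id) ∘ₗ
        ((2 : ℝ) • H.curvOp K + (3 : ℝ) • LinearMap.id) = 0) :
    ∃ (n : ℕ) (A : Fin n → H.sp), (∀ i, H.curvOp K (A i) = (7 / 2 : ℝ) • A i) ∧
      (∀ i j, frob (A i : Module.End ℝ V) (A j) = if i = j then 1 else 0) ∧
      (∀ B : H.sp, H.curvOp K B = (7 / 2 : ℝ) • B →
        (B : Module.End ℝ V) = ∑ i, frob (A i : Module.End ℝ V) B • (A i : Module.End ℝ V)) ∧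
      ∀ x y z w, (K : Tensor4 V) x y z w = 10 * ∑ i, ⟪(A i : Module.End ℝ V) x, y⟫_ℝ *
        ⟪(A i : Module.End ℝ V) z, w⟫_ℝ - (3 / 2) * ⟪H.spWedge z w x, y⟫_ℝ := by
  obtain ⟨n, A, hA, ho, hb⟩ := exists_frob_orthonormal_basis
    (Module.End.eigenspace (H.curvOp K) (7 / 2 : ℝ))
  simp only [Module.End.mem_eigenspace_iff] at hA hb
  refine ⟨n, A, hA, ho, hb, fun x y z w => ?_⟩
  have hsymm : ∀ i (B : H.sp), frob (A i : Module.End ℝ V) (H.curvOp K B) =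
      (7 / 2) * frob (A i : Module.End ℝ V) B := fun i B => by
    have h1 : frob (H.curvOp K (A i) : Module.End ℝ V) B =
      frob (A i : Module.End ℝ V) (H.curvOp K B) := frob_curvOpEnd K.2 _ _
    rw [← h1, hA]
    simp
  let B : H.sp := ⟨H.spWedge z w, H.spWedge_mem z w⟩
  -- Condition (I) puts the image of `T + 3/2` inside the 7/2-eigenspace; the later factor 1/4
  -- clears the two 2s.
  have h1 : H.curvOp K (H.curvOp K B + (3 / 2 : ℝ) • B) =
      (7 / 2 : ℝ) • (H.curvOp K B + (3 / 2 : ℝ) • B) := by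
    have := LinearMap.congr_fun hK B
    simp only [LinearMap.comp_apply, LinearMap.sub_apply, LinearMap.add_apply, LinearMap.smul_apply,
      LinearMap.id_apply, map_add, map_smul, LinearMap.zero_apply] at this ⊢
    have h4 := congrArg (fun x => (1 / 4 : ℝ) • x) this
    rw [← sub_eq_zero]
    simp only [smul_zero] at h4
    rw [← h4]
    module
  have h2 := hb _ h1
  -- The 10 is `(7/2 + 3/2) * 2`, the last 2 coming from `frob_spWedge`.
  have h3 : (H.curvOp K B : Module.End ℝ V) = ∑ i, (10 * ⟪(A i : Module.End ℝ V) z, w⟫_ℝ) •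
      (A i : Module.End ℝ V) - (3 / 2 : ℝ) • H.spWedge z w := by
    rw [eq_sub_iff_add_eq]
    refine Eq.trans h2 (Finset.sum_congr rfl fun i _ => ?_)
    congr 1
    have : ((H.curvOp K B + (3 / 2 : ℝ) • B : H.sp) : Module.End ℝ V) =
      H.curvOp K B + (3 / 2 : ℝ) • (B : Module.End ℝ V) := rfl
    rw [this, map_add, map_smul, hsymm, H.frob_spWedge (A i).2, smul_eq_mul]
    ring
  rw [← inner_curvOpEnd_spWedge K.2]
  change ⟪(H.curvOp K B : Module.End ℝ V) x, y⟫_ℝ = _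
  rw [h3]
  simp only [LinearMap.sub_apply, LinearMap.sum_apply, LinearMap.smul_apply, inner_sub_left,
    sum_inner, real_inner_smul_left, Finset.mul_sum]
  congr 1
  exact Finset.sum_congr rfl fun i _ => by ring

/-! ### The Bianchi identity in a frame -/

section

variable {ι : Type*} [Fintype ι] {c : ℝ} {A : ι → Module.End ℝ V} {K : H.curvSpace}
  (hA : ∀ i, A i ∈ H.sp)
  (hK : ∀ x y z w, (K : Tensor4 V) x y z w = c * ∑ i, ⟪A i x, y⟫_ℝ * ⟪A i z, w⟫_ℝ -
      (3 / 2) * ⟪H.spWedge z w x, y⟫_ℝ)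
include hK

theorem bianchi_sum (x y z w : V) :
    c * ∑ i, (⟪A i x, y⟫_ℝ * ⟪A i z, w⟫_ℝ + ⟪A i y, z⟫_ℝ * ⟪A i x, w⟫_ℝ +
      ⟪A i z, x⟫_ℝ * ⟪A i y, w⟫_ℝ) = (3 / 2) * (⟪H.spWedge z w x, y⟫_ℝ +
        ⟪H.spWedge x w y, z⟫_ℝ + ⟪H.spWedge y w z, x⟫_ℝ) := by
  have := K.2.2.2.1 x y z w
  rw [hK, hK, hK] at this
  simp only [Finset.sum_add_distrib]
  linarith

include hA

/-- Bianchi at `(u, J₁u, J₂u, J₃u)`. -/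
theorem IsFrame.bianchi_diag {u v : V} (h : H.IsFrame u v) :
    c * ∑ i, (⟪A i u, H.J₁ u⟫_ℝ ^ 2 + ⟪A i u, H.J₂ u⟫_ℝ ^ 2 + ⟪A i u, H.J₃ u⟫_ℝ ^ 2) = 9 / 4 := by
  have e : ∀ i, ⟪A i u, H.J₁ u⟫_ℝ ^ 2 + ⟪A i u, H.J₂ u⟫_ℝ ^ 2 + ⟪A i u, H.J₃ u⟫_ℝ ^ 2 =
      -(⟪A i u, H.J₁ u⟫_ℝ * ⟪A i (H.J₂ u), H.J₃ u⟫_ℝ +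
        ⟪A i (H.J₁ u), H.J₂ u⟫_ℝ * ⟪A i u, H.J₃ u⟫_ℝ +
        ⟪A i (H.J₂ u), u⟫_ℝ * ⟪A i (H.J₁ u), H.J₃ u⟫_ℝ) := fun i => by
    simp [map_J₁_of_mem_sp (hA _), map_J₂_of_mem_sp (hA _)]
    ring
  simp only [e, Finset.sum_neg_distrib, mul_neg, bianchi_sum hK]
  simp [-inner_self_eq_norm_sq_to_K, spWedge_apply, inner_add_left, real_inner_smul_left, h.uu]
  norm_num

/-- Bianchi at `(u, J₁u, v, J₁v)`. -/
theorem IsFrame.bianchi_mixed {u v : V} (h : H.IsFrame u v) :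
    c * ∑ i, (⟪A i u, H.J₁ u⟫_ℝ * ⟪A i v, H.J₁ v⟫_ℝ - ⟪A i u, v⟫_ℝ ^ 2 -
      ⟪A i u, H.J₁ v⟫_ℝ ^ 2) = -3 / 4 := by
  have e : ∀ i, ⟪A i u, H.J₁ u⟫_ℝ * ⟪A i v, H.J₁ v⟫_ℝ - ⟪A i u, v⟫_ℝ ^ 2 -
      ⟪A i u, H.J₁ v⟫_ℝ ^ 2 =
      ⟪A i u, H.J₁ u⟫_ℝ * ⟪A i v, H.J₁ v⟫_ℝ +
        ⟪A i (H.J₁ u), v⟫_ℝ * ⟪A i u, H.J₁ v⟫_ℝ +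
        ⟪A i v, u⟫_ℝ * ⟪A i (H.J₁ u), H.J₁ v⟫_ℝ := fun i => by
    simp [map_J₁_of_mem_sp (hA _), map_J₂_of_mem_sp (hA _), map_J₃_of_mem_sp (hA _),
      inner_map_swap_of_mem_sp (hA i) v u, inner_map_J₁_swap_of_mem_sp (hA i) v u,
      inner_map_J₂_swap_of_mem_sp (hA i) v u, inner_map_J₃_swap_of_mem_sp (hA i) v u]
    ring
  simp only [e, bianchi_sum hK]
  simp [-inner_self_eq_norm_sq_to_K, spWedge_apply, inner_add_left, inner_sub_left,
    real_inner_smul_left, h.uu, h.vv, h.uv, h.uJ₁v, h.uJ₂v, h.uJ₃v, h.vu, h.vJ₁u, h.vJ₂u, h.vJ₃u]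
  norm_num

/-- Bianchi at `(u, J₁u, J₂v, J₃v)`. -/
theorem IsFrame.bianchi_twisted {u v : V} (h : H.IsFrame u v) :
    c * ∑ i, (⟪A i u, H.J₁ u⟫_ℝ * ⟪A i v, H.J₁ v⟫_ℝ + ⟪A i u, H.J₂ v⟫_ℝ ^ 2 +
      ⟪A i u, H.J₃ v⟫_ℝ ^ 2) = 3 / 4 := by
  have e : ∀ i, ⟪A i u, H.J₁ u⟫_ℝ * ⟪A i v, H.J₁ v⟫_ℝ + ⟪A i u, H.J₂ v⟫_ℝ ^ 2 +
      ⟪A i u, H.J₃ v⟫_ℝ ^ 2 =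
      -(⟪A i u, H.J₁ u⟫_ℝ * ⟪A i (H.J₂ v), H.J₃ v⟫_ℝ +
        ⟪A i (H.J₁ u), H.J₂ v⟫_ℝ * ⟪A i u, H.J₃ v⟫_ℝ +
        ⟪A i (H.J₂ v), u⟫_ℝ * ⟪A i (H.J₁ u), H.J₃ v⟫_ℝ) := fun i => by
    simp [map_J₁_of_mem_sp (hA _), map_J₂_of_mem_sp (hA _), map_J₃_of_mem_sp (hA _),
      inner_map_swap_of_mem_sp (hA i) v u, inner_map_J₁_swap_of_mem_sp (hA i) v u,
      inner_map_J₂_swap_of_mem_sp (hA i) v u, inner_map_J₃_swap_of_mem_sp (hA i) v u]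
    ring
  simp only [e, Finset.sum_neg_distrib, mul_neg, bianchi_sum hK]
  simp [-inner_self_eq_norm_sq_to_K, spWedge_apply, inner_add_left, inner_sub_left,
    real_inner_smul_left, h.uu, h.vv, h.uv, h.uJ₁v, h.uJ₂v, h.uJ₃v, h.vu, h.vJ₁u, h.vJ₂u, h.vJ₃u]
  norm_num

end

end

section

variable {V : Type*} [NormedAddCommGroup V] [InnerProductSpace ℝ V] {H : HyperHermitian V}

/-! ### The eigenspace is three-dimensional -/

theorem IsFrame.inner_eq {u v : V} (h : H.IsFrame u v) (hV : Module.finrank ℝ V = 8) (x : V) :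
    ⟪x, x⟫_ℝ = ⟪x, u⟫_ℝ ^ 2 + ⟪x, H.J₁ u⟫_ℝ ^ 2 + ⟪x, H.J₂ u⟫_ℝ ^ 2 + ⟪x, H.J₃ u⟫_ℝ ^ 2 +
      ⟪x, v⟫_ℝ ^ 2 + ⟪x, H.J₁ v⟫_ℝ ^ 2 + ⟪x, H.J₂ v⟫_ℝ ^ 2 + ⟪x, H.J₃ v⟫_ℝ ^ 2 := by
  have e := congrArg (fun y => ⟪x, y⟫_ℝ) (h.sum_eq hV x)
  simp only [inner_add_right, real_inner_smul_right] at e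
  rw [e]
  ring

theorem inner_map_self_of_mem_sp {A : Module.End ℝ V} (hA : A ∈ H.sp) (x : V) :
    ⟪A x, x⟫_ℝ = 0 := by
  linarith [inner_map_swap_of_mem_sp hA x x]

theorem IsFrame.frob_self [FiniteDimensional ℝ V] {u v : V} (h : H.IsFrame u v)
    (hV : Module.finrank ℝ V = 8) {A : Module.End ℝ V} (hA : A ∈ H.sp) :
    frob A A = 4 * ((⟪A u, H.J₁ u⟫_ℝ ^ 2 + ⟪A u, H.J₂ u⟫_ℝ ^ 2 + ⟪A u, H.J₃ u⟫_ℝ ^ 2) +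
      (⟪A v, H.J₁ v⟫_ℝ ^ 2 + ⟪A v, H.J₂ v⟫_ℝ ^ 2 + ⟪A v, H.J₃ v⟫_ℝ ^ 2) +
      2 * (⟪A u, v⟫_ℝ ^ 2 + ⟪A u, H.J₁ v⟫_ℝ ^ 2 + ⟪A u, H.J₂ v⟫_ℝ ^ 2 + ⟪A u, H.J₃ v⟫_ℝ ^ 2)) := by
  rw [h.frob_eq hV hA hA, h.inner_eq hV, h.inner_eq hV (A v), inner_map_self_of_mem_sp hA,
    inner_map_self_of_mem_sp hA, inner_map_swap_of_mem_sp hA v u,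
    inner_map_J₁_swap_of_mem_sp hA v u, inner_map_J₂_swap_of_mem_sp hA v u,
    inner_map_J₃_swap_of_mem_sp hA v u]
  ring

/-- Summing the Bianchi relations over a frame computes `∑ frob (A i) (A i)`. In effect T_K is
traceless on the ten-dimensional `sp(2)`, so `(7/2) n = (3/2)(10 - n)`. -/
theorem card_eq_three [FiniteDimensional ℝ V] (hV : Module.finrank ℝ V = 8) {n : ℕ}
    {A : Fin n → Module.End ℝ V} {K : H.curvSpace} (hA : ∀ i, A i ∈ H.sp)
    (ho : ∀ i, frob (A i) (A i) = 1)
    (hK : ∀ x y z w, (K : Tensor4 V) x y z w = 10 * ∑ i, ⟪A i x, y⟫_ℝ * ⟪A i z, w⟫_ℝ -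
      (3 / 2) * ⟪H.spWedge z w x, y⟫_ℝ) : n = 3 := by
  -- The empty commuting family serves only to produce some frame.
  obtain ⟨u, v, h, -⟩ := H.exists_frame_of_commute hV (ι := Empty) (A := fun i => i.elim)
    (fun i => i.elim) (fun i => i.elim)
  have h1 : ∑ i, frob (A i) (A i) = n := by simp [ho]
  simp only [h.frob_self hV (hA _), ← Finset.mul_sum] at h1
  have e1 := h.bianchi_diag hA hK
  have e2 := h.swap.bianchi_diag hA hK
  have e3 := h.bianchi_mixed hA hK
  have e4 := h.bianchi_twisted hA hK
  simp only [Finset.sum_add_distrib, Finset.sum_sub_distrib, ← Finset.mul_sum] at h1 e1 e2 e3 e4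
  have : (n : ℝ) = 3 := by linarith
  exact_mod_cast this

/-- The operator conditions produce an orthonormal triple spanning a Lie subalgebra. -/
theorem exists_triple_of_conditions [FiniteDimensional ℝ V] (hV : Module.finrank ℝ V = 8)
    {K : H.curvSpace}
    (hK1 : ((2 : ℝ) • H.curvOp K - (7 : ℝ) • LinearMap.id) ∘ₗ
        ((2 : ℝ) • H.curvOp K + (3 : ℝ) • LinearMap.id) = 0)
    (hK2 : ∀ A B : H.sp, ⁅H.curvOp K A, H.curvOp K B⁆ - H.curvOp K ⁅H.curvOp K A, B⁆ =
        (3 / 2 : ℝ) • (H.curvOp K ⁅A, B⁆ - ⁅A, H.curvOp K B⁆)) :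
    ∃ (A : Fin 3 → Module.End ℝ V) (κ : ℝ), (∀ i, A i ∈ H.sp) ∧ (∀ i, frob (A i) (A i) = 1) ∧
      0 ≤ κ ∧ A 0 * A 1 - A 1 * A 0 = κ • A 2 ∧ A 0 * A 2 - A 2 * A 0 = -κ • A 1 ∧
      A 1 * A 2 - A 2 * A 1 = κ • A 0 ∧
      ∀ x y z w, (K : Tensor4 V) x y z w = 10 * ∑ i, ⟪A i x, y⟫_ℝ * ⟪A i z, w⟫_ℝ -
        (3 / 2) * ⟪H.spWedge z w x, y⟫_ℝ := by
  obtain ⟨n, A, hT, ho, hb, hK⟩ := exists_model_of_quadratic hK1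
  obtain rfl : n = 3 := card_eq_three hV (A := fun i => (A i : Module.End ℝ V)) (fun i => (A i).2)
    (fun i => by rw [ho]; simp) hK
  let B : Fin 3 → Module.End ℝ V := fun i => A i
  have hB : ∀ i, B i ∈ H.sp := fun i => (A i).2
  have hoB : ∀ i, frob (B i) (B i) = 1 := fun i => by simp only [B, ho, if_true]
  have hlie : ∀ i j, (B i * B j - B j * B i) =
      ∑ k, frob (B i * B j - B j * B i) (B k) • B k := by
    intro i j
    -- On two 7/2-eigenvectors (II) reads `5 T[Aᵢ, Aⱼ] = (35/2) [Aᵢ, Aⱼ]`, so the eigenspace is a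
    -- subalgebra.
    have h1 : H.curvOp K ⁅A i, A j⁆ = (7 / 2 : ℝ) • ⁅A i, A j⁆ := by
      have := hK2 (A i) (A j)
      simp only [hT, smul_lie, lie_smul, map_smul] at this
      have h2 := congrArg (fun x => (1 / 5 : ℝ) • x) this
      rw [← sub_eq_zero] at h2 ⊢
      rw [← neg_eq_zero, ← h2]
      module
    have h2 := hb _ h1
    simpa only [LieSubalgebra.coe_bracket, LieRing.of_associative_ring_bracket, frob_comm] using h2
  have hz : ∀ i j, frob (B i * B j - B j * B i) (B i) = 0 := fun i j => by
    rw [frob_lie (hB i), sub_self, map_zero]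
  have hz' : ∀ i j, frob (B i * B j - B j * B i) (B j) = 0 := fun i j => by
    rw [← neg_sub, map_neg, LinearMap.neg_apply, hz, neg_zero]
  have h02 : frob (B 0 * B 2 - B 2 * B 0) (B 1) =
      -frob (B 0 * B 1 - B 1 * B 0) (B 2) := by
    rw [frob_lie (hB 0), frob_comm, ← neg_sub, map_neg, LinearMap.neg_apply]
  have h12 : frob (B 1 * B 2 - B 2 * B 1) (B 0) =
      frob (B 0 * B 1 - B 1 * B 0) (B 2) := by
    rw [frob_lie (hB 1), frob_comm]
  have l01 := hlie 0 1
  have l02 := hlie 0 2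
  have l12 := hlie 1 2
  simp only [Fin.sum_univ_three, hz, hz', zero_smul, zero_add, add_zero, h02, h12] at l01 l02 l12
  -- A single structure constant remains; exchanging the first two basis vectors reverses its sign.
  rcases le_total 0 (frob (B 0 * B 1 - B 1 * B 0) (B 2)) with hκ | hκ
  · exact ⟨B, _, hB, hoB, hκ, l01, l02, l12, hK⟩
  · refine ⟨![B 1, B 0, B 2], -frob (B 0 * B 1 - B 1 * B 0) (B 2), ?_, ?_,
      neg_nonneg.mpr hκ, ?_, ?_, ?_, ?_⟩
    · intro i
      fin_cases i <;> exact (hB _)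
    · intro i
      fin_cases i <;> simp [hoB]
    · change B 1 * B 0 - B 0 * B 1 = _ • B 2
      rw [neg_smul, ← l01, neg_sub]
    · rw [neg_neg]
      exact l12
    · exact l02
    · intro x y z w
      rw [hK]
      simp [B, Fin.sum_univ_three]
      ring

/-- If the bracket vanished, all three `A i` would be diagonal in one frame; then `bianchi_mixed`
and `bianchi_twisted` would give the same sum two opposite nonzero values. -/
theorem pos_of_lie [FiniteDimensional ℝ V] (hV : Module.finrank ℝ V = 8)
    {A : Fin 3 → Module.End ℝ V} {K : H.curvSpace} {κ : ℝ} (hA : ∀ i, A i ∈ H.sp)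
    (hκ : 0 ≤ κ) (h01 : A 0 * A 1 - A 1 * A 0 = κ • A 2) (h02 : A 0 * A 2 - A 2 * A 0 = -κ • A 1)
    (h12 : A 1 * A 2 - A 2 * A 1 = κ • A 0)
    (hK : ∀ x y z w, (K : Tensor4 V) x y z w = 10 * ∑ i, ⟪A i x, y⟫_ℝ * ⟪A i z, w⟫_ℝ -
      (3 / 2) * ⟪H.spWedge z w x, y⟫_ℝ) : 0 < κ := by
  refine lt_of_le_of_ne hκ fun h0 => ?_
  subst h0
  simp only [zero_smul, neg_zero, sub_eq_zero] at h01 h02 h12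
  obtain ⟨u, v, h, hd⟩ := H.exists_frame_of_commute hV hA (fun i j => by
    fin_cases i <;> fin_cases j <;>
      first
      | exact Commute.refl _
      | exact h01
      | exact h02
      | exact h12
      | exact h01.symm
      | exact h02.symm
      | exact h12.symm)
  choose hdu hdv using hd
  choose a ha using hdu
  choose b hb using hdv
  have e3 := h.bianchi_mixed hA hK
  have e4 := h.bianchi_twisted hA hK
  simp [-inner_self_eq_norm_sq_to_K, ha, hb, real_inner_smul_left, real_inner_smul_right, h.uu, h.vv,
    h.uv, h.uJ₁v, h.uJ₂v, h.uJ₃v] at e3 e4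
  linarith

/-- Moves a diagonal element into the Weyl chamber: `J₂` changes the sign of a weight, and swapping
`u` and `v` permutes the weights. -/
theorem exists_frame_diagonal [FiniteDimensional ℝ V] (hV : Module.finrank ℝ V = 8)
    {A : Module.End ℝ V} (hA : A ∈ H.sp) :
    ∃ (u v : V) (a b : ℝ), H.IsFrame u v ∧ A u = a • H.J₁ u ∧ A v = b • H.J₁ v ∧ 0 ≤ b ∧ b ≤ a := by
  obtain ⟨u, v, h, hd⟩ := H.exists_frame_of_commute hV (ι := Unit) (A := fun _ => A)
    (fun _ => hA) (fun _ _ => Commute.refl _)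
  obtain ⟨⟨a, ha⟩, b, hb⟩ := hd ()
  have key : ∀ {u v : V} {a b : ℝ}, H.IsFrame u v → A u = a • H.J₁ u → A v = b • H.J₁ v →
      ∃ (u' : V), H.IsFrame u' v ∧ A u' = |a| • H.J₁ u' := by
    intro u v a b h ha hb
    rcases le_total 0 a with h0 | h0
    · exact ⟨u, h, by rw [abs_of_nonneg h0, ha]⟩
    · refine ⟨H.J₂ u, h.map_J₂_left, ?_⟩
      rw [abs_of_nonpos h0, map_J₂_of_mem_sp hA, ha]
      simp
  obtain ⟨u, h, ha⟩ := key h ha hb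
  obtain ⟨v, h, hb⟩ := key h.swap hb ha
  rcases le_total |a| |b| with h0 | h0
  · exact ⟨v, u, _, _, h, hb, ha, abs_nonneg _, h0⟩
  · exact ⟨u, v, _, _, h.swap, ha, hb, abs_nonneg _, h0⟩

end

section

variable {V : Type*} [NormedAddCommGroup V] [InnerProductSpace ℝ V] {H : HyperHermitian V}

/-! ### Classification -/

/-- The components of `[A, B] = κ C` in a frame diagonalizing `A`. -/
theorem lie_components {u v : V} {A B C : Module.End ℝ V} {a b κ : ℝ}
    (hA : A ∈ H.sp) (hB : B ∈ H.sp) (hu : A u = a • H.J₁ u) (hv : A v = b • H.J₁ v)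
    (hl : A * B - B * A = κ • C) :
    (κ * ⟪C u, H.J₁ u⟫_ℝ = 0 ∧ κ * ⟪C u, H.J₂ u⟫_ℝ = 2 * a * ⟪B u, H.J₃ u⟫_ℝ ∧
      κ * ⟪C u, H.J₃ u⟫_ℝ = -(2 * a * ⟪B u, H.J₂ u⟫_ℝ)) ∧
    (κ * ⟪C v, H.J₁ v⟫_ℝ = 0 ∧ κ * ⟪C v, H.J₂ v⟫_ℝ = 2 * b * ⟪B v, H.J₃ v⟫_ℝ ∧
      κ * ⟪C v, H.J₃ v⟫_ℝ = -(2 * b * ⟪B v, H.J₂ v⟫_ℝ)) ∧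
    κ * ⟪C u, v⟫_ℝ = (a - b) * ⟪B u, H.J₁ v⟫_ℝ ∧
    κ * ⟪C u, H.J₁ v⟫_ℝ = -((a - b) * ⟪B u, v⟫_ℝ) ∧
    κ * ⟪C u, H.J₂ v⟫_ℝ = (a + b) * ⟪B u, H.J₃ v⟫_ℝ ∧
    κ * ⟪C u, H.J₃ v⟫_ℝ = -((a + b) * ⟪B u, H.J₂ v⟫_ℝ) := by
  have key : ∀ x y : V, κ * ⟪C x, y⟫_ℝ = -⟪B x, A y⟫_ℝ - ⟪B (A x), y⟫_ℝ := fun x y => by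
    rw [← real_inner_smul_left, ← LinearMap.smul_apply, ← hl, LinearMap.sub_apply,
      Module.End.mul_apply, Module.End.mul_apply, inner_sub_left, inner_map_of_mem_sp hA, neg_neg]
  refine ⟨⟨?_, ?_, ?_⟩, ⟨?_, ?_, ?_⟩, ?_, ?_, ?_, ?_⟩ <;> rw [key] <;>
    simp [map_J₁_of_mem_sp hA, map_J₂_of_mem_sp hA, map_J₃_of_mem_sp hA, map_J₁_of_mem_sp hB,
      hu, hv, real_inner_smul_left, real_inner_smul_right, inner_map_self_of_mem_sp hB] <;> ring

/-- `a, b` are the weights of `A 0`. The letters `aᵢ, bᵢ, pᵢ` are components of `A 1` (from `u` to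
`u`, `v` to `v`, `u` to `v`), and `cᵢ, dᵢ, qᵢ` those of `A 2`. A component in a root space survives
only if κ matches that root up to sign. Bianchi needs the short root `a - b` to survive, so `κ² = (a
- b)² < (2a)²` and the long root `2a` dies. Then `10 a² = 9/4`, and the norm of `A 0` gives `a =
3b`, `κ = 2b`. -/
theorem scalar_classification {a b κ a₂ a₃ c₂ c₃ b₂ b₃ d₂ d₃ p₀ p₁ p₂ p₃ q₀ q₁ q₂ q₃ : ℝ}
    (hb : 0 ≤ b) (hab : b ≤ a) (hκ : 0 < κ)
    (hn : 4 * (a ^ 2 + b ^ 2) = 1)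
    (hu : 10 * (a ^ 2 + (a₂ ^ 2 + a₃ ^ 2) + (c₂ ^ 2 + c₃ ^ 2)) = 9 / 4)
    (hv : 10 * (b ^ 2 + (b₂ ^ 2 + b₃ ^ 2) + (d₂ ^ 2 + d₃ ^ 2)) = 9 / 4)
    (hm : 10 * (a * b - (p₀ ^ 2 + q₀ ^ 2) - (p₁ ^ 2 + q₁ ^ 2)) = -3 / 4)
    (ht : 10 * (a * b + (p₂ ^ 2 + p₃ ^ 2) + (q₂ ^ 2 + q₃ ^ 2)) = 3 / 4)
    (ha2 : κ * c₂ = 2 * a * a₃) (ha3 : κ * c₃ = -(2 * a * a₂))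
    (hc2 : -κ * a₂ = 2 * a * c₃) (hc3 : -κ * a₃ = -(2 * a * c₂))
    (hb2 : κ * d₂ = 2 * b * b₃) (hb3 : κ * d₃ = -(2 * b * b₂))
    (hd2 : -κ * b₂ = 2 * b * d₃) (hd3 : -κ * b₃ = -(2 * b * d₂))
    (hp0 : κ * q₀ = (a - b) * p₁) (hp1 : κ * q₁ = -((a - b) * p₀))
    (hq0 : -κ * p₀ = (a - b) * q₁) (hq1 : -κ * p₁ = -((a - b) * q₀)) :
    0 < b ∧ a = 3 * b ∧ 40 * b ^ 2 = 1 ∧ (a₂ = 0 ∧ a₃ = 0 ∧ c₂ = 0 ∧ c₃ = 0) ∧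
      (p₂ = 0 ∧ p₃ = 0 ∧ q₂ = 0 ∧ q₃ = 0) ∧ (d₂ = b₃ ∧ d₃ = -b₂ ∧ q₀ = p₁ ∧ q₁ = -p₀) ∧
      b₂ ^ 2 + b₃ ^ 2 = 4 * b ^ 2 ∧ p₀ ^ 2 + p₁ ^ 2 = 3 * b ^ 2 := by
  have ha : 0 < a := by
    refine lt_of_le_of_ne (hb.trans hab) fun h0 => ?_
    obtain rfl : b = 0 := le_antisymm (hab.trans h0.ge) hb
    rw [← h0] at hn
    norm_num at hn
  have hP : κ ^ 2 ≠ (a - b) ^ 2 → False := fun hne => by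
    have hne' : κ ^ 2 - (a - b) ^ 2 ≠ 0 := sub_ne_zero.mpr hne
    have e0 : p₀ = 0 := (mul_eq_zero.mp (show (κ ^ 2 - (a - b) ^ 2) * p₀ = 0 by
      linear_combination -κ * hq0 - (a - b) * hp1)).resolve_left hne'
    have e1 : p₁ = 0 := (mul_eq_zero.mp (show (κ ^ 2 - (a - b) ^ 2) * p₁ = 0 by
      linear_combination -κ * hq1 + (a - b) * hp0)).resolve_left hne'
    have e2 : q₀ = 0 := (mul_eq_zero.mp (show κ * q₀ = 0 by rw [hp0, e1, mul_zero])).resolve_left hκ.ne'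
    have e3 : q₁ = 0 := (mul_eq_zero.mp (show κ * q₁ = 0 by rw [hp1, e0]; ring)).resolve_left hκ.ne'
    rw [e0, e1, e2, e3] at hm
    linarith [mul_nonneg ha.le hb]
  have hκa : κ ^ 2 - (2 * a) ^ 2 ≠ 0 := fun h0 => hP fun h1 => by
    have : 0 < (a + b) * (3 * a - b) := mul_pos (by linarith) (by linarith)
    linarith
  have e0 : a₂ = 0 := (mul_eq_zero.mp (show (κ ^ 2 - (2 * a) ^ 2) * a₂ = 0 by
    linear_combination -κ * hc2 - 2 * a * ha3)).resolve_left hκa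
  have e1 : a₃ = 0 := (mul_eq_zero.mp (show (κ ^ 2 - (2 * a) ^ 2) * a₃ = 0 by
    linear_combination -κ * hc3 + 2 * a * ha2)).resolve_left hκa
  have e2 : c₂ = 0 := (mul_eq_zero.mp (show κ * c₂ = 0 by rw [ha2, e1, mul_zero])).resolve_left hκ.ne'
  have e3 : c₃ = 0 := (mul_eq_zero.mp (show κ * c₃ = 0 by rw [ha3, e0]; ring)).resolve_left hκ.ne'
  rw [e0, e1, e2, e3] at hu
  have hb0 : 0 < b := by
    refine lt_of_le_of_ne hb fun h0 => ?_
    rw [← h0] at hn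
    linarith
  have h3 : a = 3 * b := by
    have : (a - 3 * b) * (a + 3 * b) = 0 := by linarith
    rcases mul_eq_zero.mp this with h | h <;> linarith
  subst h3
  have hbb : 40 * b ^ 2 = 1 := by linarith
  have hκb : κ = 2 * b := by
    by_contra hne
    refine hP fun h0 => hne ?_
    have : (κ - 2 * b) * (κ + 2 * b) = 0 := by linarith
    rcases mul_eq_zero.mp this with h | h <;> linarith
  subst hκb
  have c2 : d₂ = b₃ := mul_left_cancel₀ hκ.ne' hb2
  have c3 : d₃ = -b₂ := mul_left_cancel₀ hκ.ne' (by linarith)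
  have c0 : q₀ = p₁ := mul_left_cancel₀ hκ.ne' (by linarith)
  have c1 : q₁ = -p₀ := mul_left_cancel₀ hκ.ne' (by linarith)
  have hQ : p₂ ^ 2 + p₃ ^ 2 + q₂ ^ 2 + q₃ ^ 2 = 0 := by linarith
  refine ⟨hb0, rfl, hbb, ⟨e0, e1, e2, e3⟩, ⟨?_, ?_, ?_, ?_⟩, ⟨c2, c3, c0, c1⟩, ?_, ?_⟩
  · exact pow_eq_zero_iff two_ne_zero |>.mp (le_antisymm
      (by linarith [sq_nonneg p₃, sq_nonneg q₂, sq_nonneg q₃]) (sq_nonneg _))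
  · exact pow_eq_zero_iff two_ne_zero |>.mp (le_antisymm
      (by linarith [sq_nonneg p₂, sq_nonneg q₂, sq_nonneg q₃]) (sq_nonneg _))
  · exact pow_eq_zero_iff two_ne_zero |>.mp (le_antisymm
      (by linarith [sq_nonneg p₂, sq_nonneg p₃, sq_nonneg q₃]) (sq_nonneg _))
  · exact pow_eq_zero_iff two_ne_zero |>.mp (le_antisymm
      (by linarith [sq_nonneg p₂, sq_nonneg p₃, sq_nonneg q₂]) (sq_nonneg _))
  · rw [c2, c3] at hv
    linarith
  · rw [c0, c1] at hm
    linarith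

theorem IsFrame.rotate_left {u v : V} (h : H.IsFrame u v) {α β : ℝ} (hαβ : α ^ 2 + β ^ 2 = 1) :
    H.IsFrame (α • u + β • H.J₁ u) v := by
  constructor <;> simp [-inner_self_eq_norm_sq_to_K, inner_add_left, inner_add_right,
    real_inner_smul_left, real_inner_smul_right, h.uu, h.vv, h.uv, h.uJ₁v, h.uJ₂v, h.uJ₃v]
  linarith

/-- The operator conditions force the curvature tensor to be the model of a principal triple. -/
theorem exists_isPrincipal_of_conditions [FiniteDimensional ℝ V] (hV : Module.finrank ℝ V = 8)
    {K : H.curvSpace}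
    (hK1 : ((2 : ℝ) • H.curvOp K - (7 : ℝ) • LinearMap.id) ∘ₗ
        ((2 : ℝ) • H.curvOp K + (3 : ℝ) • LinearMap.id) = 0)
    (hK2 : ∀ A B : H.sp, ⁅H.curvOp K A, H.curvOp K B⁆ - H.curvOp K ⁅H.curvOp K A, B⁆ =
        (3 / 2 : ℝ) • (H.curvOp K ⁅A, B⁆ - ⁅A, H.curvOp K B⁆)) :
    ∃ (u v : V) (A : Fin 3 → Module.End ℝ V), H.IsFrame u v ∧ H.IsPrincipal u v A ∧
      ∀ x y z w, (K : Tensor4 V) x y z w = (1 / 4 : ℝ) * ∑ i, ⟪A i x, y⟫_ℝ * ⟪A i z, w⟫_ℝ -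
        (3 / 2) * ⟪H.spWedge z w x, y⟫_ℝ := by
  obtain ⟨A, κ, hA, ho, hκ0, h01, h02, h12, hK⟩ := exists_triple_of_conditions hV hK1 hK2
  have hκ := pos_of_lie hV hA hκ0 h01 h02 h12 hK
  obtain ⟨u, v, a, b, h, hu, hv, hb, hab⟩ := exists_frame_diagonal hV (hA 0)
  obtain ⟨⟨x1, x2, x3⟩, ⟨y1, y2, y3⟩, z0, z1, z2, z3⟩ := lie_components (hA 0) (hA 1) hu hv h01
  obtain ⟨⟨x1', x2', x3'⟩, ⟨y1', y2', y3'⟩, z0', z1', z2', z3'⟩ :=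
    lie_components (hA 0) (hA 2) hu hv h02
  have hz : ∀ {x : ℝ}, κ * x = 0 → x = 0 := fun h => (mul_eq_zero.mp h).resolve_left hκ.ne'
  have hz' : ∀ {x : ℝ}, -κ * x = 0 → x = 0 := fun h => hz (by linarith)
  have n0 := ho 0
  have bu := h.bianchi_diag hA hK
  have bv := h.swap.bianchi_diag hA hK
  have bm := h.bianchi_mixed hA hK
  have bt := h.bianchi_twisted hA hK
  rw [h.frob_self hV (hA 0)] at n0
  simp [-inner_self_eq_norm_sq_to_K, Fin.sum_univ_three, hu, hv, real_inner_smul_left, h.uu, h.vv,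
    h.uv, h.uJ₁v, h.uJ₂v, h.uJ₃v, hz x1, hz y1, hz' x1', hz' y1'] at n0 bu bv bm bt
  obtain ⟨hb0, rfl, hbb, ⟨e0, e1, e2, e3⟩, ⟨f0, f1, f2, f3⟩, ⟨g0, g1, g2, g3⟩, hβ, hP⟩ :=
    scalar_classification hb hab hκ n0 bu bv bm bt
      x2 x3 x2' x3' y2 y3 y2' y3' z0 z1 z0' z1'
  have hb2 : 2 * b ≠ 0 := by positivity
  have h3 : √3 * √3 = (3 : ℝ) := Real.mul_self_sqrt (by norm_num)
  have h3p : √3 * b ≠ 0 := by positivity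
  -- Angle of the rotation in the plane of `A 1, A 2` that removes the `J₃ v` component of the first
  -- image of `v`.
  obtain ⟨c, s, hc, hs, hcs⟩ : ∃ c s : ℝ, ⟪A 1 v, H.J₂ v⟫_ℝ = 2 * b * c ∧
      ⟪A 1 v, H.J₃ v⟫_ℝ = 2 * b * s ∧ c ^ 2 + s ^ 2 = 1 := by
    refine ⟨⟪A 1 v, H.J₂ v⟫_ℝ / (2 * b), ⟪A 1 v, H.J₃ v⟫_ℝ / (2 * b), by field_simp, by field_simp, ?_⟩
    rw [div_pow, div_pow, ← add_div, hβ]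
    field_simp
    norm_num
  -- Phase by which `u` is turned in its `J₁`-complex line so that the rotated `A 1` maps it to a
  -- multiple of `v`.
  obtain ⟨α, β, hα, hβ', hαβ⟩ : ∃ α β : ℝ, ⟪A 1 u, v⟫_ℝ = √3 * b * (-c * α - s * β) ∧
      ⟪A 1 u, H.J₁ v⟫_ℝ = √3 * b * (c * β - s * α) ∧ α ^ 2 + β ^ 2 = 1 := by
    refine ⟨(-c * ⟪A 1 u, v⟫_ℝ - s * ⟪A 1 u, H.J₁ v⟫_ℝ) / (√3 * b),
      (c * ⟪A 1 u, H.J₁ v⟫_ℝ - s * ⟪A 1 u, v⟫_ℝ) / (√3 * b), ?_, ?_, ?_⟩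
    · field_simp
      linear_combination (-⟪A 1 u, v⟫_ℝ) * hcs
    · field_simp
      linear_combination (-⟪A 1 u, H.J₁ v⟫_ℝ) * hcs
    · rw [div_pow, div_pow, ← add_div, div_eq_one_iff_eq (by positivity)]
      linear_combination (⟪A 1 u, v⟫_ℝ ^ 2 + ⟪A 1 u, H.J₁ v⟫_ℝ ^ 2) * hcs + hP - b ^ 2 * h3
  have hu1 := h.sum_eq hV (A 1 u)
  have hv1 := h.sum_eq hV (A 1 v)
  have hu2 := h.sum_eq hV (A 2 u)
  have hv2 := h.sum_eq hV (A 2 v)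
  rw [inner_map_swap_of_mem_sp (hA _) v u, inner_map_J₁_swap_of_mem_sp (hA _) v u,
    inner_map_J₂_swap_of_mem_sp (hA _) v u, inner_map_J₃_swap_of_mem_sp (hA _) v u] at hv1 hv2
  simp only [inner_map_self_of_mem_sp (hA _), hz x1, hz y1, hz' x1', hz' y1', e0, e1, e2, e3, f0, f1,
    f2, f3, g0, g1, g2, g3, hc, hs, hα, hβ', zero_smul, zero_add, add_zero] at hu1 hv1 hu2 hv2
  have k1u : (c • A 1 + s • A 2) u = -(√3 * b * α) • v + (√3 * b * β) • H.J₁ v := by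
    rw [LinearMap.add_apply, LinearMap.smul_apply, LinearMap.smul_apply, hu1, hu2]
    match_scalars
    · linear_combination (-√3 * b * α) * hcs
    · linear_combination (√3 * b * β) * hcs
  have k2u : (-s • A 1 + c • A 2) u = (√3 * b * β) • v + (√3 * b * α) • H.J₁ v := by
    rw [LinearMap.add_apply, LinearMap.smul_apply, LinearMap.smul_apply, hu1, hu2]
    match_scalars
    · linear_combination (√3 * b * β) * hcs
    · linear_combination (√3 * b * α) * hcs
  have k1v : (c • A 1 + s • A 2) v = (√3 * b * α) • u + (√3 * b * β) • H.J₁ u +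
      (2 * b) • H.J₂ v := by
    rw [LinearMap.add_apply, LinearMap.smul_apply, LinearMap.smul_apply, hv1, hv2]
    match_scalars
    · linear_combination (√3 * b * α) * hcs
    · linear_combination (√3 * b * β) * hcs
    · linear_combination (2 * b) * hcs
    · ring
  have k2v : (-s • A 1 + c • A 2) v = -(√3 * b * β) • u + (√3 * b * α) • H.J₁ u -
      (2 * b) • H.J₃ v := by
    rw [LinearMap.add_apply, LinearMap.smul_apply, LinearMap.smul_apply, hv1, hv2]
    match_scalars
    · linear_combination (-√3 * b * β) * hcs
    · linear_combination (√3 * b * α) * hcs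
    · ring
    · linear_combination (-2 * b) * hcs
  have m1 : c • A 1 + s • A 2 ∈ H.sp :=
    add_mem (H.sp.smul_mem c (hA 1)) (H.sp.smul_mem s (hA 2))
  have m2 : -s • A 1 + c • A 2 ∈ H.sp :=
    add_mem (H.sp.smul_mem (-s) (hA 1)) (H.sp.smul_mem c (hA 2))
  have hbi : b⁻¹ * b = 1 := inv_mul_cancel₀ hb0.ne'
  refine ⟨α • u + β • H.J₁ u, v,
    ![b⁻¹ • A 0, b⁻¹ • (c • A 1 + s • A 2), b⁻¹ • (-s • A 1 + c • A 2)],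
    h.rotate_left hαβ, ⟨?_, ?_, ?_, ?_, ?_, ?_, ?_⟩, fun x y z w => ?_⟩
  · intro i
    fin_cases i
    · exact H.sp.smul_mem _ (hA 0)
    · exact H.sp.smul_mem _ m1
    · exact H.sp.smul_mem _ m2
  · change b⁻¹ • A 0 _ = _
    rw [map_add, map_smul, map_smul, map_J₁_of_mem_sp (hA 0), hu]
    simp only [map_add, map_smul, J₁_J₁]
    match_scalars
    · linear_combination (3 * α) * hbi
    · linear_combination (-3 * β) * hbi
  · change b⁻¹ • A 0 v = _
    rw [hv, smul_smul, hbi, one_smul]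
  · change b⁻¹ • (c • A 1 + s • A 2) _ = _
    rw [map_add, map_smul, map_smul, map_J₁_of_mem_sp m1, k1u]
    simp only [map_add, map_smul, J₁_J₁]
    match_scalars
    · linear_combination (-√3 * b⁻¹ * b) * hαβ - √3 * hbi
    · ring
  · change b⁻¹ • (c • A 1 + s • A 2) v = _
    rw [k1v]
    match_scalars
    · linear_combination (√3 * α) * hbi
    · linear_combination (√3 * β) * hbi
    · linear_combination 2 * hbi
  · change b⁻¹ • (-s • A 1 + c • A 2) _ = _
    rw [map_add, map_smul, map_smul, map_J₁_of_mem_sp m2, k2u]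
    simp only [map_add, map_smul, J₁_J₁]
    match_scalars
    · ring
    · linear_combination (√3 * b⁻¹ * b) * hαβ + √3 * hbi
  · change b⁻¹ • (-s • A 1 + c • A 2) v = _
    rw [k2v]
    simp only [map_add, map_smul, J₁_J₁]
    match_scalars
    · linear_combination (-√3 * β) * hbi
    · linear_combination (√3 * α) * hbi
    · linear_combination -2 * hbi
  -- Rescaling by `b⁻¹` makes the weights 3 and 1; since `b⁻² = 40`, the coefficient 10 becomes 1/4.
  · have hbi2 : b⁻¹ ^ 2 = 40 := by
      rw [inv_pow, inv_eq_iff_eq_inv, ← mul_right_inj' (show (40 : ℝ) ≠ 0 by norm_num), hbb]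
      norm_num
    rw [hK]
    simp only [Fin.sum_univ_three, Matrix.cons_val_zero, Matrix.cons_val_one, Matrix.cons_val,
      LinearMap.smul_apply, LinearMap.add_apply, inner_add_left, real_inner_smul_left]
    linear_combination
      (-(1 / 4 : ℝ) * (⟪A 0 x, y⟫_ℝ * ⟪A 0 z, w⟫_ℝ + (c ^ 2 + s ^ 2) * (⟪A 1 x, y⟫_ℝ * ⟪A 1 z, w⟫_ℝ +
        ⟪A 2 x, y⟫_ℝ * ⟪A 2 z, w⟫_ℝ))) * hbi2 -
      10 * (⟪A 1 x, y⟫_ℝ * ⟪A 1 z, w⟫_ℝ + ⟪A 2 x, y⟫_ℝ * ⟪A 2 z, w⟫_ℝ) * hcs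

end

section

variable {V : Type*} [NormedAddCommGroup V] [InnerProductSpace ℝ V] (H : HyperHermitian V)

/-! ### The symmetric tensor of a curvature tensor -/

theorem symTensor_swap_left {K : Tensor4 V} (hK : K ∈ H.curvSpace) (x y z w : V) :
    H.symTensor K y x z w = H.symTensor K x y z w := by
  have hs := H.curvSpace_pair_symm hK
  obtain ⟨h1, -, -, -, h5, h6⟩ := hK
  have e2 : ∀ x y z w, K y (H.J₂ x) z w = K x (H.J₂ y) z w := fun x y z w => by
    rw [hs y, ← h5, ← hs, H.J₂_J₂, map_neg, LinearMap.neg_apply, LinearMap.neg_apply, h1]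
    simp
  have e3 : ∀ x y z w, K y (H.J₃ x) z w = K x (H.J₃ y) z w := fun x y z w => by
    rw [hs y, ← h6, ← hs, H.J₃_J₃, map_neg, LinearMap.neg_apply, LinearMap.neg_apply, h1]
    simp
  rw [symTensor_apply, symTensor_apply, e2, e3]

theorem symTensor_pair {K : Tensor4 V} (hK : K ∈ H.curvSpace) (x y z w : V) :
    H.symTensor K z w x y = H.symTensor K x y z w := by
  rw [symTensor_apply, symTensor_apply, H.curvSpace_pair_symm hK z, H.curvSpace_pair_symm hK z]

/-- In the Bianchi identities with `J₂` and with `J₃` in slots two and four, the third terms both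
equal `K z x y w` and cancel on subtraction. -/
theorem symTensor_swap_middle {K : Tensor4 V} (hK : K ∈ H.curvSpace) (x y z w : V) :
    H.symTensor K z y x w = H.symTensor K x y z w := by
  obtain ⟨h1, -, h3, -, h5, h6⟩ := hK
  rw [symTensor_apply, symTensor_apply]
  have e2 := h3 x (H.J₂ y) z (H.J₂ w)
  have e3 := h3 x (H.J₃ y) z (H.J₃ w)
  rw [h1 z, h5] at e2
  rw [h1 z, h6] at e3
  linarith

/-- A curvature tensor is recovered from its symmetric tensor. -/
theorem eq_symTensor_add {K : Tensor4 V} (hK : ∀ x y z w, K x y (H.J₂ z) (H.J₂ w) = K x y z w)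
    (x y z w : V) : K x (H.J₂ y) z (H.J₂ w) =
      H.symTensor K x y z w + H.symTensor K x y (H.J₂ z) (H.J₂ w) := by
  have e1 := hK x (H.J₂ y) z (H.J₂ w)
  have e2 := hK x (H.J₃ y) z (H.J₃ w)
  simp only [symTensor_apply, J₂_J₂, J₃_J₂, J₂_J₃, map_neg] at e1 e2 ⊢
  linarith

/-- Polarization: the three given permutations generate the whole symmetric group on the slots. -/
theorem tensor4_eq_zero_of_diag {D : Tensor4 V} (h1 : ∀ x y z w, D y x z w = D x y z w)
    (h2 : ∀ x y z w, D z w x y = D x y z w) (h3 : ∀ x y z w, D z y x w = D x y z w)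
    (h0 : ∀ x, D x x x x = 0) (x y z w : V) : D x y z w = 0 := by
  have h4 : ∀ x y z w, D x y w z = D x y z w := fun x y z w => by rw [h2, h1, h2]
  have s1 : ∀ x y, D x x x y = 0 := fun x y => by
    have e1 := h0 (x + y)
    have e2 := h0 (x - y)
    have e3 := h0 (x + (2 : ℝ) • y)
    have e4 := h0 (x - (2 : ℝ) • y)
    simp only [map_add, map_sub, map_smul, LinearMap.add_apply, LinearMap.sub_apply,
      LinearMap.smul_apply, smul_eq_mul, h0] at e1 e2 e3 e4
    linarith [h4 x x x y, h2 x x x y, h1 x y x x, h4 y y y x, h2 y y y x, h1 y x y y]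
  have s2 : ∀ x y z, D x x y z = 0 := fun x y z => by
    have e1 := s1 (x + y) z
    have e2 := s1 (x - y) z
    simp only [map_add, map_sub, LinearMap.add_apply, LinearMap.sub_apply, s1] at e1 e2
    linarith [h1 x y x z, h3 x x y z, h1 x y y z, h3 x y y z]
  have e1 := s2 (x + y) z w
  simp only [map_add, LinearMap.add_apply, s2, h1 x y] at e1
  linarith

/-! ### The model tensor -/

/-- The tensor product of two bilinear forms. -/
def tensorMul (B C : V →ₗ[ℝ] V →ₗ[ℝ] ℝ) : Tensor4 V :=
  LinearMap.mk₂ ℝ (fun x y => B x y • C)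
    (fun x x' y => by rw [map_add, LinearMap.add_apply, add_smul])
    (fun c x y => by rw [map_smul, LinearMap.smul_apply, smul_assoc])
    (fun x y y' => by rw [map_add, add_smul])
    (fun c x y => by rw [map_smul, smul_assoc])

@[simp] theorem tensorMul_apply (B C : V →ₗ[ℝ] V →ₗ[ℝ] ℝ) (x y z w : V) :
    tensorMul B C x y z w = B x y * C z w := rfl

/-- The Kulkarni–Nomizu type square of a bilinear form. -/
def wedgeSq (B : V →ₗ[ℝ] V →ₗ[ℝ] ℝ) : Tensor4 V :=
  LinearMap.mk₂ ℝ (fun x y => LinearMap.mk₂ ℝ (fun z w => B z x * B w y - B w x * B z y)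
      (fun z z' w => by simp only [map_add, LinearMap.add_apply]; ring)
      (fun c z w => by simp only [map_smul, LinearMap.smul_apply, smul_eq_mul]; ring)
      (fun z w w' => by simp only [map_add, LinearMap.add_apply]; ring)
      (fun c z w => by simp only [map_smul, LinearMap.smul_apply, smul_eq_mul]; ring))
    (fun x x' y => LinearMap.ext₂ fun z w => by simp; ring)
    (fun c x y => LinearMap.ext₂ fun z w => by simp; ring)
    (fun x y y' => LinearMap.ext₂ fun z w => by simp; ring)
    (fun c x y => LinearMap.ext₂ fun z w => by simp; ring)

@[simp] theorem wedgeSq_apply (B : V →ₗ[ℝ] V →ₗ[ℝ] ℝ) (x y z w : V) :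
    wedgeSq B x y z w = B z x * B w y - B w x * B z y := rfl

/-- The tensor `¼ ∑ᵢ g(Aᵢ x, y) g(Aᵢ z, w) - (3/2) g(P(z, w) x, y)` with `P(z, w)` the projection of
`wedge z w` to `sp(2)`. -/
def modelTensor (A : Fin 3 → Module.End ℝ V) : Tensor4 V :=
  (1 / 4 : ℝ) • ∑ i, tensorMul (innerₗ V ∘ₗ A i) (innerₗ V ∘ₗ A i) -
    (3 / 2 : ℝ) • (1 / 4 : ℝ) • (wedgeSq (innerₗ V) + wedgeSq (innerₗ V ∘ₗ H.J₁) +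
      wedgeSq (innerₗ V ∘ₗ H.J₂) + wedgeSq (innerₗ V ∘ₗ H.J₃))

theorem modelTensor_apply (A : Fin 3 → Module.End ℝ V) (x y z w : V) :
    H.modelTensor A x y z w = (1 / 4 : ℝ) * ∑ i, ⟪A i x, y⟫_ℝ * ⟪A i z, w⟫_ℝ -
      (3 / 2) * ⟪H.spWedge z w x, y⟫_ℝ := by
  simp only [modelTensor, spWedge_apply, LinearMap.sub_apply, LinearMap.smul_apply,
    LinearMap.add_apply, LinearMap.sum_apply, tensorMul_apply, wedgeSq_apply, LinearMap.comp_apply,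
    innerₗ_apply_apply, smul_eq_mul, inner_add_left, inner_sub_left, real_inner_smul_left]

/-- The complex symplectic form of `(V, J₁)`. -/
def symp : V →ₗ[ℝ] V →ₗ[ℝ] ℂ :=
  LinearMap.mk₂ ℝ (fun x y => ⟨⟪x, H.J₂ y⟫_ℝ, ⟪x, H.J₃ y⟫_ℝ⟩)
    (fun x x' y => by apply Complex.ext <;> simp [inner_add_left])
    (fun c x y => by apply Complex.ext <;> simp [real_inner_smul_left])
    (fun x y y' => by apply Complex.ext <;> simp [inner_add_right])
    (fun c x y => by apply Complex.ext <;> simp [real_inner_smul_right])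

@[simp] theorem symp_re (x y : V) : (H.symp x y).re = ⟪x, H.J₂ y⟫_ℝ := rfl

@[simp] theorem symp_im (x y : V) : (H.symp x y).im = ⟪x, H.J₃ y⟫_ℝ := rfl

theorem symp_J₁ (x y : V) : H.symp (H.J₁ x) y = Complex.I * H.symp x y := by
  apply Complex.ext <;> simp

theorem symp_swap (x y : V) : H.symp x y = -H.symp y x := by
  apply Complex.ext <;> simp [real_inner_comm _ x]

theorem symp_self (x : V) : H.symp x x = 0 := by
  apply Complex.ext <;> simp

theorem symp_map_swap {H : HyperHermitian V} {A : Module.End ℝ V} (hA : A ∈ H.sp) (x y : V) :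
    H.symp (A x) y = H.symp (A y) x := by
  apply Complex.ext
  · exact inner_map_J₂_swap_of_mem_sp hA x y
  · exact inner_map_J₃_swap_of_mem_sp hA x y

/-- The `J₂` and `J₃` components are the real and imaginary parts of `symp`, so the difference
defining S is the real part of a complex product. -/
theorem symTensor_model {K : Tensor4 V} {A : Fin 3 → Module.End ℝ V}
    (hK : ∀ x y z w, K x y z w = (1 / 4 : ℝ) * ∑ i, ⟪A i x, y⟫_ℝ * ⟪A i z, w⟫_ℝ -
      (3 / 2) * ⟪H.spWedge z w x, y⟫_ℝ) (x y z w : V) :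
    H.symTensor K x y z w = ((1 / 8 : ℂ) * (∑ i, H.symp (A i x) y * H.symp (A i z) w -
      3 * (H.symp x w * H.symp y z + H.symp x z * H.symp y w))).re := by
  have e : ∀ z : ℂ, ((1 / 8 : ℂ) * z).re = 1 / 8 * z.re := fun z => by
    simp [Complex.mul_re]
  rw [symTensor_apply, hK, hK, e]
  simp only [Fin.sum_univ_three, spWedge_apply, inner_add_left, inner_sub_left,
    real_inner_smul_left, Complex.sub_re, Complex.add_re, Complex.mul_re, symp_re, symp_im,
    Complex.re_ofNat, Complex.im_ofNat, inner_J₁_left, inner_J₂_left, inner_J₃_left, J₁_J₁, J₁_J₂,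
    J₁_J₃, J₂_J₁, J₂_J₂, J₂_J₃, J₃_J₁, J₃_J₂, J₃_J₃, inner_neg_right, inner_neg_left, real_inner_comm _ x,
    real_inner_comm _ y]
  ring

end

section

variable {V : Type*} [NormedAddCommGroup V] [InnerProductSpace ℝ V] {H : HyperHermitian V}

/-! ### Complex coordinates in a frame -/

/-- `symp` is complex linear for `J₁` in its first slot, so `symp x u`, `symp x v`, `symp x (J₂ u)`,
`symp x (J₂ v)` serve as complex coordinates of `x`. -/
theorem IsFrame.symp_eq {u v : V} (h : H.IsFrame u v) (hV : Module.finrank ℝ V = 8)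
    {A : Module.End ℝ V} (hA1 : ∀ x, A (H.J₁ x) = H.J₁ (A x))
    (hA2 : ∀ x, A (H.J₂ x) = H.J₂ (A x)) (hA3 : ∀ x, A (H.J₃ x) = H.J₃ (A x)) (x y : V) :
    H.symp (A x) y = -H.symp x (H.J₂ u) * H.symp (A u) y + H.symp x u * H.symp (H.J₂ (A u)) y -
      H.symp x (H.J₂ v) * H.symp (A v) y + H.symp x v * H.symp (H.J₂ (A v)) y := by
  have e : ∀ s, H.symp (H.J₃ s) y = Complex.I * H.symp (H.J₂ s) y := fun s => by
    rw [← H.J₁_J₂, symp_J₁]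
  have c : ∀ s t, H.symp s t = (⟪s, H.J₂ t⟫_ℝ : ℂ) + ⟪s, H.J₃ t⟫_ℝ * Complex.I := fun s t =>
    (Complex.re_add_im _).symm
  conv_lhs => rw [h.sum_eq hV x]
  simp only [map_add, map_smul, LinearMap.add_apply, LinearMap.smul_apply, hA1, hA2, hA3, e, symp_J₁,
    Complex.real_smul]
  rw [c x, c x, c x, c x]
  simp only [J₂_J₂, J₃_J₂, inner_neg_right, Complex.ofReal_neg]
  ring

theorem IsFrame.symp_eq_coord {u v : V} (h : H.IsFrame u v) (hV : Module.finrank ℝ V = 8) (x y : V) :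
    H.symp x y = H.symp x (H.J₂ u) * H.symp y u - H.symp x u * H.symp y (H.J₂ u) +
      H.symp x (H.J₂ v) * H.symp y v - H.symp x v * H.symp y (H.J₂ v) := by
  have := h.symp_eq hV (A := LinearMap.id) (fun _ => rfl) (fun _ => rfl) (fun _ => rfl) x y
  simp only [LinearMap.id_apply] at this
  rw [this, H.symp_swap u, H.symp_swap v, H.symp_swap (H.J₂ u), H.symp_swap (H.J₂ v)]
  ring

namespace IsPrincipal

variable {u v : V} {A : Fin 3 → Module.End ℝ V} (hA : H.IsPrincipal u v A) (h : H.IsFrame u v)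
  (hV : Module.finrank ℝ V = 8)
include hA h hV

theorem symp_zero (x y : V) : H.symp (A 0 x) y =
    Complex.I * (3 * (H.symp x (H.J₂ u) * H.symp y u + H.symp x u * H.symp y (H.J₂ u)) +
      (H.symp x (H.J₂ v) * H.symp y v + H.symp x v * H.symp y (H.J₂ v))) := by
  have hm := hA.mem 0
  rw [h.symp_eq hV (map_J₁_of_mem_sp hm) (map_J₂_of_mem_sp hm) (map_J₃_of_mem_sp hm), hA.zero_u,
    hA.zero_v]
  simp only [map_smul, map_neg, LinearMap.smul_apply, LinearMap.neg_apply, J₂_J₁, ← J₁_J₂, symp_J₁,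
    Complex.real_smul, H.symp_swap u, H.symp_swap v, H.symp_swap (H.J₂ u), H.symp_swap (H.J₂ v)]
  push_cast
  ring

theorem symp_one (x y : V) : H.symp (A 1 x) y =
    2 * (H.symp x (H.J₂ v) * H.symp y (H.J₂ v) + H.symp x v * H.symp y v) -
      (√3 : ℝ) * (H.symp x (H.J₂ u) * H.symp y v + H.symp x v * H.symp y (H.J₂ u)) +
      (√3 : ℝ) * (H.symp x (H.J₂ v) * H.symp y u + H.symp x u * H.symp y (H.J₂ v)) := by
  have hm := hA.mem 1
  rw [h.symp_eq hV (map_J₁_of_mem_sp hm) (map_J₂_of_mem_sp hm) (map_J₃_of_mem_sp hm), hA.one_u,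
    hA.one_v]
  simp only [map_add, map_smul, map_neg, LinearMap.smul_apply, LinearMap.neg_apply,
    LinearMap.add_apply, J₂_J₂,
    Complex.real_smul, H.symp_swap u, H.symp_swap v, H.symp_swap (H.J₂ u), H.symp_swap (H.J₂ v)]
  push_cast
  ring

theorem symp_two (x y : V) : H.symp (A 2 x) y =
    -Complex.I * (2 * (H.symp x (H.J₂ v) * H.symp y (H.J₂ v) - H.symp x v * H.symp y v) -
      (√3 : ℝ) * (H.symp x (H.J₂ u) * H.symp y v + H.symp x v * H.symp y (H.J₂ u)) -
      (√3 : ℝ) * (H.symp x (H.J₂ v) * H.symp y u + H.symp x u * H.symp y (H.J₂ v))) := by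
  have hm := hA.mem 2
  rw [h.symp_eq hV (map_J₁_of_mem_sp hm) (map_J₂_of_mem_sp hm) (map_J₃_of_mem_sp hm), hA.two_u,
    hA.two_v]
  simp only [map_sub, map_smul, map_neg, LinearMap.smul_apply, LinearMap.neg_apply,
    LinearMap.sub_apply, J₂_J₁, J₂_J₂, ← J₁_J₂, symp_J₁,
    Complex.real_smul, H.symp_swap u, H.symp_swap v, H.symp_swap (H.J₂ u), H.symp_swap (H.J₂ v)]
  push_cast
  ring

/-- Supplies the symmetry of S for the model without knowing beforehand that the model satisfies
Bianchi; in coordinates it is a polynomial identity modulo `√3² = 3` and `I² = -1`. -/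
theorem symTensor_swap_middle {K : Tensor4 V}
    (hK : ∀ x y z w, K x y z w = (1 / 4 : ℝ) * ∑ i, ⟪A i x, y⟫_ℝ * ⟪A i z, w⟫_ℝ -
      (3 / 2) * ⟪H.spWedge z w x, y⟫_ℝ) (x y z w : V) :
    H.symTensor K z y x w = H.symTensor K x y z w := by
  rw [H.symTensor_model hK, H.symTensor_model hK]
  have h3 : ((√3 : ℝ) : ℂ) ^ 2 = 3 := by
    rw [← Complex.ofReal_pow, Real.sq_sqrt (by norm_num)]; norm_num
  have hI : Complex.I ^ 2 = -1 := Complex.I_sq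
  congr 2
  simp only [Fin.sum_univ_three, hA.symp_zero h hV, hA.symp_one h hV, hA.symp_two h hV,
    h.symp_eq_coord hV x w, h.symp_eq_coord hV y z, h.symp_eq_coord hV x z, h.symp_eq_coord hV y w,
    h.symp_eq_coord hV z w, h.symp_eq_coord hV y x, h.symp_eq_coord hV z x]
  generalize ((√3 : ℝ) : ℂ) = r at *
  generalize H.symp x (H.J₂ u) = x0
  generalize H.symp x (H.J₂ v) = x1
  generalize H.symp x u = x2
  generalize H.symp x v = x3
  generalize H.symp y (H.J₂ u) = y0
  generalize H.symp y (H.J₂ v) = y1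
  generalize H.symp y u = y2
  generalize H.symp y v = y3
  generalize H.symp z (H.J₂ u) = z0
  generalize H.symp z (H.J₂ v) = z1
  generalize H.symp z u = z2
  generalize H.symp z v = z3
  generalize H.symp w (H.J₂ u) = w0
  generalize H.symp w (H.J₂ v) = w1
  generalize H.symp w u = w2
  generalize H.symp w v = w3
  ring_nf
  simp only [h3, hI]
  ring

/-- The first form and the combinations `A 1 ± i A 2` of the others are multiples of the Hessian
coefficients `bc - 9ad`, `b² - 3ac`, `c² - 3bd`, and the sum of squares is the discriminant of that
Hessian up to a factor. The √2 absorbs the scale. -/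
theorem sum_symp_sq (x : V) : ∑ i, H.symp (A i x) x * H.symp (A i x) x =
    discQuartic ![-((√2 : ℝ) * H.symp x (H.J₂ u)), -((√2 : ℝ) * H.symp x (H.J₂ v)),
      (√2 : ℝ) * H.symp x u, (√2 : ℝ) * H.symp x v] := by
  have h3 : ((√3 : ℝ) : ℂ) ^ 2 = 3 := by
    rw [← Complex.ofReal_pow, Real.sq_sqrt (by norm_num)]; norm_num
  have h2 : ((√2 : ℝ) : ℂ) ^ 4 = 4 := by
    rw [show (4 : ℕ) = 2 * 2 from rfl, pow_mul, ← Complex.ofReal_pow, Real.sq_sqrt (by norm_num)]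
    norm_num
  have hI : Complex.I ^ 2 = -1 := Complex.I_sq
  simp only [Fin.sum_univ_three, hA.symp_zero h hV, hA.symp_one h hV, hA.symp_two h hV, discQuartic,
    Matrix.cons_val]
  generalize ((√3 : ℝ) : ℂ) = r at *
  generalize ((√2 : ℝ) : ℂ) = t at *
  ring_nf
  simp only [h3, hI, h2]
  ring

end IsPrincipal

end

section

variable {V : Type*} [NormedAddCommGroup V] [InnerProductSpace ℝ V] (H : HyperHermitian V)

/-! ### The holomorphic part of a vector -/

theorem holo_mem (x : V) :
    ((1 : ℂ) ⊗ₜ[ℝ] x - Complex.I ⊗ₜ[ℝ] H.J₁ x : Complexify V) ∈ H.W := by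
  rw [W, Module.End.mem_eigenspace_iff, endC, map_sub, LinearMap.baseChange_tmul,
    LinearMap.baseChange_tmul, H.J₁_J₁, smul_sub, TensorProduct.smul_tmul', TensorProduct.smul_tmul',
    smul_eq_mul, smul_eq_mul, Complex.I_mul_I, mul_one, TensorProduct.tmul_neg,
    TensorProduct.neg_tmul]
  abel

/-- The real isomorphism `V → W`, `x ↦ x - i J₁ x`. -/
def holo : V →ₗ[ℝ] H.W where
  toFun x := ⟨(1 : ℂ) ⊗ₜ[ℝ] x - Complex.I ⊗ₜ[ℝ] H.J₁ x, H.holo_mem x⟩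
  map_add' x y := Subtype.ext (by
    simp only [map_add, TensorProduct.tmul_add, Submodule.coe_add]
    abel)
  map_smul' c x := Subtype.ext (by
    simp only [map_smul, TensorProduct.tmul_smul, RingHom.id_apply]
    exact (smul_sub c _ _).symm)

theorem coe_holo (x : V) :
    (H.holo x : Complexify V) = (1 : ℂ) ⊗ₜ[ℝ] x - Complex.I ⊗ₜ[ℝ] H.J₁ x := rfl

theorem holo_J₁ (x : V) : H.holo (H.J₁ x) = Complex.I • H.holo x := by
  refine Subtype.ext ?_
  rw [Submodule.coe_smul, coe_holo, coe_holo, H.J₁_J₁, smul_sub, TensorProduct.smul_tmul',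
    TensorProduct.smul_tmul', smul_eq_mul, smul_eq_mul, Complex.I_mul_I, mul_one,
    TensorProduct.tmul_neg, TensorProduct.neg_tmul]
  abel

theorem j_holo (x : V) : H.j (H.holo x) = H.holo (H.J₂ x) := by
  have h1 : conjC ((1 : ℂ) ⊗ₜ[ℝ] x) = (1 : ℂ) ⊗ₜ[ℝ] x := by simp [conjC]
  have h2 : conjC (Complex.I ⊗ₜ[ℝ] H.J₁ x) = (-Complex.I) ⊗ₜ[ℝ] H.J₁ x := by simp [conjC]
  rw [j, coe_holo, coe_holo, map_sub, h1, h2, endC, map_sub, LinearMap.baseChange_tmul,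
    LinearMap.baseChange_tmul, H.J₂_J₁, H.J₁_J₂, TensorProduct.neg_tmul, TensorProduct.tmul_neg]
  abel

theorem exists_holo_eq (x : H.W) : ∃ y, H.holo y = x := by
  have h1 : ∀ x : Complexify V, ∃ a b : V, x = (1 : ℂ) ⊗ₜ[ℝ] a + Complex.I ⊗ₜ[ℝ] b := by
    intro x
    induction x using TensorProduct.induction_on with
    | zero => exact ⟨0, 0, by simp⟩
    | tmul z v =>
      refine ⟨z.re • v, z.im • v, ?_⟩
      rw [← TensorProduct.smul_tmul, ← TensorProduct.smul_tmul, ← TensorProduct.add_tmul]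
      congr 1
      apply Complex.ext <;> simp
    | add x y hx hy =>
      obtain ⟨a, b, rfl⟩ := hx
      obtain ⟨c, d, rfl⟩ := hy
      refine ⟨a + c, b + d, ?_⟩
      rw [TensorProduct.tmul_add, TensorProduct.tmul_add]
      abel
  obtain ⟨a, b, hab⟩ := h1 x
  have h2 : endC H.J₁ (x : Complexify V) = Complex.I • (x : Complexify V) :=
    Module.End.mem_eigenspace_iff.mp x.2
  have h3 : (x : Complexify V) = (1 / 2 : ℂ) • ((x : Complexify V) -
      Complex.I • endC H.J₁ (x : Complexify V)) := by
    rw [h2, smul_smul, Complex.I_mul_I]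
    module
  -- On `W` one has `x = ½(x - i J₁x)`; for `x = a + ib` this is the holomorphic part of `½(a +
  -- J₁b)`.
  refine ⟨(1 / 2 : ℝ) • (a + H.J₁ b), Subtype.ext ?_⟩
  rw [map_smul, h3]
  change (1 / 2 : ℝ) • (H.holo (a + H.J₁ b) : Complexify V) = _
  have h4 : ∀ y : Complexify V, (1 / 2 : ℝ) • y = (1 / 2 : ℂ) • y := fun y => by
    rw [← algebraMap_smul ℂ (1 / 2 : ℝ) y]
    norm_num
  rw [h4, hab, coe_holo, endC, map_add (LinearMap.baseChange ℂ H.J₁), LinearMap.baseChange_tmul,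
    LinearMap.baseChange_tmul, map_add, H.J₁_J₁, smul_add, TensorProduct.smul_tmul',
    TensorProduct.smul_tmul', smul_eq_mul, smul_eq_mul, Complex.I_mul_I, mul_one,
    TensorProduct.tmul_add, TensorProduct.tmul_add, TensorProduct.tmul_neg, TensorProduct.neg_tmul]
  congr 1
  abel

/-- `pi` as a bilinear map. -/
def piₗ : Complexify V →ₗ[ℂ] Complexify V →ₗ[ℂ] ℂ :=
  -(bilinC (innerₗ V)).compl₂ (endC H.J₂)

theorem piₗ_apply (x y : Complexify V) : H.piₗ x y = H.pi x y := rfl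

theorem pi_holo (x y : V) : H.pi (H.holo x) (H.holo y) = -2 * H.symp x y := by
  rw [pi, coe_holo, coe_holo, endC]
  simp only [map_sub, LinearMap.sub_apply, LinearMap.baseChange_tmul, bilinC_tmul,
    innerₗ_apply_apply]
  apply Complex.ext <;> simp <;> ring

/-- As `J₁` may be moved to the first slot, the four arguments contribute `(1 - i J₁)⁴ = 8 (1 - i
J₁)`. -/
theorem tensor4C_holo {S : Tensor4 V} (h2 : ∀ x y z w, S x (H.J₁ y) z w = S (H.J₁ x) y z w)
    (h3 : ∀ x y z w, S x y (H.J₁ z) w = S (H.J₁ x) y z w)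
    (h4 : ∀ x y z w, S x y z (H.J₁ w) = S (H.J₁ x) y z w) (x y z w : V) :
    tensor4C S (H.holo x) (H.holo y) (H.holo z) (H.holo w) =
      8 * (S x y z w - Complex.I * S (H.J₁ x) y z w) := by
  simp only [coe_holo, map_sub, LinearMap.sub_apply, tensor4C_tmul, h2, h3, h4, J₁_J₁, map_neg,
    LinearMap.neg_apply]
  apply Complex.ext <;> simp <;> ring

theorem tensor4C_symTensor_holo {K : Tensor4 V} (hK : K ∈ H.curvSpace) (x : V) :
    tensor4C (H.symTensor K) (H.holo x) (H.holo x) (H.holo x) (H.holo x) =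
      8 * (H.symTensor K x x x x - Complex.I * H.symTensor K (H.J₁ x) x x x) := by
  have e2 : ∀ x y z w, H.symTensor K x (H.J₁ y) z w = H.symTensor K (H.J₁ x) y z w := by
    intro x y z w
    have hs := H.curvSpace_pair_symm hK
    obtain ⟨-, -, -, h4, -, -⟩ := hK
    have f : ∀ x y z w, K (H.J₁ x) (H.J₁ y) z w = K x y z w := fun x y z w => by
      rw [hs, h4, hs]
    have f2 := f x (H.J₃ y) z (H.J₂ w)
    have f3 := f x (H.J₂ y) z (H.J₃ w)
    simp only [symTensor_apply, J₁_J₃, J₁_J₂, J₂_J₁, J₃_J₁, map_neg, LinearMap.neg_apply] at f2 f3 ⊢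
    linarith
  have s1 := H.symTensor_swap_left hK
  have s2 := H.symTensor_pair hK
  have s3 := H.symTensor_swap_middle hK
  have s23 : ∀ x y z w, H.symTensor K x z y w = H.symTensor K x y z w := fun x y z w => by
    rw [s1, s3, s1]
  have s34 : ∀ x y z w, H.symTensor K x y w z = H.symTensor K x y z w := fun x y z w => by
    rw [s2, s1, s2]
  have e3 : ∀ x y z w, H.symTensor K x y (H.J₁ z) w = H.symTensor K (H.J₁ x) y z w :=
    fun x y z w => by rw [s23, e2, s23]
  have e4 : ∀ x y z w, H.symTensor K x y z (H.J₁ w) = H.symTensor K (H.J₁ x) y z w :=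
    fun x y z w => by rw [s34, e3, s34]
  exact H.tensor4C_holo e2 e3 e4 x x x x

end

section

variable {V : Type*} [NormedAddCommGroup V] [InnerProductSpace ℝ V] {H : HyperHermitian V}

/-! ### Adapted bases and frames -/

theorem IsAdapted.repr_holo {e : Module.Basis (Fin 4) ℂ H.W} (he : H.IsAdapted e) {u v : V}
    (hu : e 0 = H.holo ((√2)⁻¹ • u)) (hv : e 1 = H.holo ((√2)⁻¹ • v)) (x : V) :
    ⇑(e.repr (H.holo x)) = ![-((√2 : ℝ) * H.symp x (H.J₂ u)), -((√2 : ℝ) * H.symp x (H.J₂ v)),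
      (√2 : ℝ) * H.symp x u, (√2 : ℝ) * H.symp x v] := by
  have hu2 : e 2 = H.holo ((√2)⁻¹ • H.J₂ u) := Subtype.ext (by
    rw [he.j_zero, hu, j_holo, map_smul])
  have hv2 : e 3 = H.holo ((√2)⁻¹ • H.J₂ v) := Subtype.ext (by
    rw [he.j_one, hv, j_holo, map_smul])
  have h2 : (2 : ℂ) * ((√2)⁻¹ : ℝ) = (√2 : ℝ) := by
    have : (2 : ℝ) * (√2)⁻¹ = √2 := by
      rw [← div_eq_mul_inv, Real.div_sqrt]
    exact_mod_cast this
  have p : ∀ y, H.pi (H.holo x) (H.holo ((√2)⁻¹ • y)) = -((√2 : ℝ) * H.symp x y) := fun y => by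
    rw [pi_holo, map_smul, Complex.real_smul, ← h2]
    ring
  have q0 := he.pi_eq (H.holo x) (e 0)
  have q1 := he.pi_eq (H.holo x) (e 1)
  have q2 := he.pi_eq (H.holo x) (e 2)
  have q3 := he.pi_eq (H.holo x) (e 3)
  rw [Module.Basis.repr_self] at q0 q1 q2 q3
  rw [hu, p] at q0
  rw [hv, p] at q1
  rw [hu2, p] at q2
  rw [hv2, p] at q3
  simp at q0 q1 q2 q3
  funext i
  fin_cases i
  · simp [← q2]
  · simp [← q3]
  · simp [q0]
  · simp [q1]

/-- By `pi_holo`, the values of `π` on the basis are `-2` times inner products of the real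
preimages, which explains the factor √2. -/
theorem IsAdapted.exists_frame {e : Module.Basis (Fin 4) ℂ H.W} (he : H.IsAdapted e) :
    ∃ u v, H.IsFrame u v ∧ e 0 = H.holo ((√2)⁻¹ • u) ∧ e 1 = H.holo ((√2)⁻¹ • v) := by
  obtain ⟨u', hu'⟩ := H.exists_holo_eq (e 0)
  obtain ⟨v', hv'⟩ := H.exists_holo_eq (e 1)
  have h0 : √2 ≠ 0 := by positivity
  have hs : √2 * √2 = (2 : ℝ) := Real.mul_self_sqrt (by norm_num)
  have hu2 : e 2 = H.holo (H.J₂ u') := Subtype.ext (by rw [he.j_zero, ← hu', j_holo])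
  have hv2 : e 3 = H.holo (H.J₂ v') := Subtype.ext (by rw [he.j_one, ← hv', j_holo])
  have q1 := he.pi_eq (e 0) (e 1)
  have q2 := he.pi_eq (e 0) (e 2)
  have q3 := he.pi_eq (e 0) (e 3)
  have q4 := he.pi_eq (e 1) (e 3)
  simp only [Module.Basis.repr_self] at q1 q2 q3 q4
  rw [← hu', ← hv', pi_holo] at q1
  rw [← hu', hu2, pi_holo] at q2
  rw [← hu', hv2, pi_holo] at q3
  rw [← hv', hv2, pi_holo] at q4
  simp [-inner_self_eq_norm_sq_to_K, Complex.ext_iff] at q1 q2 q3 q4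
  refine ⟨√2 • u', √2 • v', ⟨?_, ?_, ?_, ?_, ?_, ?_⟩, ?_, ?_⟩
  · rw [real_inner_smul_left, real_inner_smul_right]
    linear_combination q2 + ⟪u', u'⟫_ℝ * hs
  · rw [real_inner_smul_left, real_inner_smul_right]
    linear_combination q4 + ⟪v', v'⟫_ℝ * hs
  · simp [real_inner_smul_left, real_inner_smul_right, q3.1]
  · simp [real_inner_smul_left, real_inner_smul_right, q3.2]
  · simp [real_inner_smul_left, real_inner_smul_right, q1.1]
  · simp [real_inner_smul_left, real_inner_smul_right, q1.2]
  · rw [inv_smul_smul₀ h0, hu']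
  · rw [inv_smul_smul₀ h0, hv']

theorem IsFrame.exists_adapted {u v : V} (h : H.IsFrame u v) (hV : Module.finrank ℝ V = 8) :
    ∃ e : Module.Basis (Fin 4) ℂ H.W, H.IsAdapted e ∧ e 0 = H.holo ((√2)⁻¹ • u) ∧
      e 1 = H.holo ((√2)⁻¹ • v) := by
  let f : Fin 4 → V := ![u, v, H.J₂ u, H.J₂ v]
  let w : Fin 4 → H.W := fun i => H.holo ((√2)⁻¹ • f i)
  have h0 : √2 ≠ 0 := by positivity
  have hs : √2 * √2 = (2 : ℝ) := Real.mul_self_sqrt (by norm_num)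
  have hsi : ((√2)⁻¹ : ℝ) * (√2)⁻¹ = 1 / 2 := by rw [← mul_inv, hs]; norm_num
  have hsum : ∀ x : V, H.holo x = ∑ i, (![-((√2 : ℝ) * H.symp x (H.J₂ u)),
      -((√2 : ℝ) * H.symp x (H.J₂ v)), (√2 : ℝ) * H.symp x u,
      (√2 : ℝ) * H.symp x v] : Fin 4 → ℂ) i • w i := fun x => by
    have hr : ∀ (r : ℝ) (y : H.W), r • y = (r : ℂ) • y := fun r y =>
      (algebraMap_smul ℂ r y).symm
    have hc : ∀ s t, H.symp s t = (⟪s, H.J₂ t⟫_ℝ : ℂ) + ⟪s, H.J₃ t⟫_ℝ * Complex.I := fun s t =>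
      (Complex.re_add_im _).symm
    have h1 : ((√2 : ℝ) : ℂ) * ((√2)⁻¹ : ℝ) = 1 := by
      rw [← Complex.ofReal_mul, mul_inv_cancel₀ h0, Complex.ofReal_one]
    have hw : ∀ (z : ℂ) y, ((√2 : ℝ) * z) • H.holo ((√2)⁻¹ • y) = z • H.holo y := fun z y => by
      rw [map_smul, hr, smul_smul, mul_right_comm, h1, one_mul]
    rw [Fin.sum_univ_four]
    simp only [w, f, Matrix.cons_val, neg_smul, hw]
    conv_lhs => rw [h.sum_eq hV x]
    simp only [map_add, map_smul, hr, holo_J₁, ← J₁_J₂, hc, J₁_J₁, J₂_J₂, J₂_J₁]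
    simp only [J₁_J₂, J₃_J₂, map_neg, inner_neg_right, Complex.ofReal_neg]
    module
  have hli : LinearIndependent ℂ w := by
    rw [Fintype.linearIndependent_iff]
    intro g hg
    -- Independence follows from the nondegenerate Gram matrix of `π`.
    have hpi : ∀ i k, H.pi (w i) (w k) =
        (![![0, 0, 1, 0], ![0, 0, 0, 1], ![-1, 0, 0, 0], ![0, -1, 0, 0]] : Fin 4 → Fin 4 → ℂ) i k := by
      intro i k
      have e1 : H.pi (w i) (w k) = -H.symp (f i) (f k) := by
        rw [pi_holo, map_smul, map_smul, LinearMap.smul_apply, smul_smul, hsi, Complex.real_smul]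
        push_cast
        ring
      rw [e1]
      fin_cases i <;> fin_cases k <;> simp [-inner_self_eq_norm_sq_to_K, f, Complex.ext_iff, h.uu,
        h.vv, h.uv, h.uJ₁v, h.uJ₂v, h.uJ₃v, h.vu, h.vJ₁u, h.vJ₂u, h.vJ₃u]
    have hp : ∀ k : Fin 4, ∑ i, g i * H.pi (w i) (w k) = 0 := fun k => by
      have := congrArg (fun x : H.W => H.piₗ (x : Complexify V) (w k)) hg
      simpa [piₗ_apply, Fin.sum_univ_four] using this
    simp only [hpi, Fin.sum_univ_four, Fin.forall_fin_succ, Matrix.cons_val] at hp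
    simp at hp
    intro i
    fin_cases i <;> simp [hp]
  have hspan : ⊤ ≤ Submodule.span ℂ (Set.range w) := fun x _ => by
    obtain ⟨y, rfl⟩ := H.exists_holo_eq x
    rw [hsum y]
    exact Submodule.sum_mem _ fun i _ => Submodule.smul_mem _ _ (Submodule.subset_span ⟨i, rfl⟩)
  let e := Module.Basis.mk hli hspan
  have hew : ∀ i, e i = w i := fun i => Module.Basis.mk_apply hli hspan i
  have hrepr : ∀ x, ⇑(e.repr (H.holo x)) = ![-((√2 : ℝ) * H.symp x (H.J₂ u)),
      -((√2 : ℝ) * H.symp x (H.J₂ v)), (√2 : ℝ) * H.symp x u, (√2 : ℝ) * H.symp x v] :=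
    fun x => by
      rw [hsum x]
      simp only [← hew]
      exact e.repr_sum_self _
  refine ⟨e, ⟨?_, ?_, fun x y => ?_⟩, hew 0, hew 1⟩
  · rw [hew, hew, j_holo, map_smul]
    rfl
  · rw [hew, hew, j_holo, map_smul]
    rfl
  · obtain ⟨x, rfl⟩ := H.exists_holo_eq x
    obtain ⟨y, rfl⟩ := H.exists_holo_eq y
    have hs' : ((√2 : ℝ) : ℂ) * (√2 : ℝ) = 2 := by rw [← Complex.ofReal_mul, hs]; norm_num
    rw [hrepr, hrepr, pi_holo, h.symp_eq_coord hV]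
    simp only [Matrix.cons_val]
    linear_combination (1 : ℂ) * ((H.symp x (H.J₂ u) * H.symp y u - H.symp x u * H.symp y (H.J₂ u) +
      H.symp x (H.J₂ v) * H.symp y v - H.symp x v * H.symp y (H.J₂ v))) * hs'

/-! ### The orbit of the cubic discriminant -/

theorem IsPrincipal.symTensor_diag {u v : V} {A : Fin 3 → Module.End ℝ V}
    (hA : H.IsPrincipal u v A) (h : H.IsFrame u v) (hV : Module.finrank ℝ V = 8) {K : Tensor4 V}
    (hK : ∀ x y z w, K x y z w = (1 / 4 : ℝ) * ∑ i, ⟪A i x, y⟫_ℝ * ⟪A i z, w⟫_ℝ -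
      (3 / 2) * ⟪H.spWedge z w x, y⟫_ℝ) (x : V) :
    H.symTensor K x x x x = (1 / 8) * (discQuartic
      ![-((√2 : ℝ) * H.symp x (H.J₂ u)), -((√2 : ℝ) * H.symp x (H.J₂ v)),
      (√2 : ℝ) * H.symp x u, (√2 : ℝ) * H.symp x v]).re ∧
    H.symTensor K (H.J₁ x) x x x = -(1 / 8) * (discQuartic
      ![-((√2 : ℝ) * H.symp x (H.J₂ u)), -((√2 : ℝ) * H.symp x (H.J₂ v)),
      (√2 : ℝ) * H.symp x u, (√2 : ℝ) * H.symp x v]).im := by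
  have e : ∀ z : ℂ, ((1 / 8 : ℂ) * z).re = 1 / 8 * z.re := fun z => by simp [Complex.mul_re]
  rw [H.symTensor_model hK, H.symTensor_model hK, ← hA.sum_symp_sq h hV, e, e]
  simp only [map_J₁_of_mem_sp (hA.mem _), symp_J₁, symp_self, mul_zero, zero_mul, add_zero, sub_zero,
    mul_assoc, ← Finset.mul_sum, Complex.I_mul_re]
  exact ⟨trivial, by ring⟩

theorem mem_cubicDiscriminants_iff (hV : Module.finrank ℝ V = 8) (K : H.curvSpace) :
    K ∈ H.cubicDiscriminants ↔
    ∃ (u v : V) (A : Fin 3 → Module.End ℝ V), H.IsFrame u v ∧ H.IsPrincipal u v A ∧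
      ∀ x y z w, (K : Tensor4 V) x y z w = (1 / 4 : ℝ) * ∑ i, ⟪A i x, y⟫_ℝ * ⟪A i z, w⟫_ℝ -
        (3 / 2) * ⟪H.spWedge z w x, y⟫_ℝ := by
  constructor
  · rintro ⟨e, he, hq⟩
    obtain ⟨u, v, h, hu, hv⟩ := he.exists_frame
    obtain ⟨A, hA⟩ := h.exists_isPrincipal
    refine ⟨u, v, A, h, hA, ?_⟩
    have hM := H.modelTensor_apply A
    -- Both tensors S are totally symmetric, so comparing them on the diagonal, where both are the
    -- discriminant quartic, suffices.
    have hS : ∀ x y z w, H.symTensor K x y z w = H.symTensor (H.modelTensor A) x y z w := by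
      intro x y z w
      rw [← sub_eq_zero]
      have hl : ∀ x y z w, H.symTensor (H.modelTensor A) y x z w =
          H.symTensor (H.modelTensor A) x y z w := fun x y z w => by
        rw [H.symTensor_model hM, H.symTensor_model hM]
        simp only [symp_map_swap (hA.mem _) y x]
        congr 3
        ring
      have hp : ∀ x y z w, H.symTensor (H.modelTensor A) z w x y =
          H.symTensor (H.modelTensor A) x y z w := fun x y z w => by
        rw [H.symTensor_model hM, H.symTensor_model hM, H.symp_swap z y, H.symp_swap w x,
          H.symp_swap z x, H.symp_swap w y]
        simp only [mul_comm (H.symp (A _ z) w)]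
        congr 3
        ring
      refine tensor4_eq_zero_of_diag (D := H.symTensor K - H.symTensor (H.modelTensor A))
        (fun x y z w => ?_) (fun x y z w => ?_) (fun x y z w => ?_) (fun x => ?_) x y z w
      · simp only [LinearMap.sub_apply, H.symTensor_swap_left K.2 x, hl x]
      · simp only [LinearMap.sub_apply, H.symTensor_pair K.2 x, hp x]
      · simp only [LinearMap.sub_apply, H.symTensor_swap_middle K.2 x,
          hA.symTensor_swap_middle h hV hM x]
      · have h1 := hq (H.holo x)
        rw [he.repr_holo hu hv, H.tensor4C_symTensor_holo K.2] at h1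
        have h2 := congrArg Complex.re h1
        have h3 := (hA.symTensor_diag h hV hM x).1
        simp at h2
        simp only [LinearMap.sub_apply, h3]
        linarith
    intro x y z w
    rw [← hM]
    have hMJ : ∀ x y z w, H.modelTensor A x y (H.J₂ z) (H.J₂ w) = H.modelTensor A x y z w := by
      intro x y z w
      rw [hM, hM, H.inner_spWedge_swap, H.inner_spWedge_swap _ _ z w]
      simp only [map_J₂_of_mem_sp (hA.mem _), map_J₂_of_mem_sp (H.spWedge_mem _ _), H.J₂_isometry]
    have hKJ : ∀ x y z w, (K : Tensor4 V) x y (H.J₂ z) (H.J₂ w) = (K : Tensor4 V) x y z w :=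
      K.2.2.2.2.2.1
    -- The argument `J₂ y` and the inner `J₂` cancel up to sign, and `z, w` range freely, so
    -- equality of S gives equality of all values of the tensors.
    have e1 := H.eq_symTensor_add hKJ x (H.J₂ y) z (H.J₂ w)
    have e2 := H.eq_symTensor_add hMJ x (H.J₂ y) z (H.J₂ w)
    rw [hS, hS, ← e2] at e1
    simpa using e1
  · rintro ⟨u, v, A, h, hA, hK⟩
    obtain ⟨e, he, hu, hv⟩ := h.exists_adapted hV
    refine ⟨e, he, fun x => ?_⟩
    obtain ⟨x, rfl⟩ := H.exists_holo_eq x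
    rw [he.repr_holo hu hv, H.tensor4C_symTensor_holo K.2, (hA.symTensor_diag h hV hK x).1,
      (hA.symTensor_diag h hV hK x).2]
    apply Complex.ext <;> simp

end

end HyperHermitian

end CubicDiscriminant

end

open CubicDiscriminant in
theorem mainTheorem3 {V : Type*} [NormedAddCommGroup V] [InnerProductSpace ℝ V]
    [FiniteDimensional ℝ V] (hV : Module.finrank ℝ V = 8) (H : HyperHermitian V)
    (K : H.curvSpace) :
    K ∈ H.cubicDiscriminants ↔
      ((2 : ℝ) • H.curvOp K - (7 : ℝ) • LinearMap.id) ∘ₗ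
        ((2 : ℝ) • H.curvOp K + (3 : ℝ) • LinearMap.id) = 0 ∧
      ∀ A B : H.sp, ⁅H.curvOp K A, H.curvOp K B⁆ - H.curvOp K ⁅H.curvOp K A, B⁆ =
        (3 / 2 : ℝ) • (H.curvOp K ⁅A, B⁆ - ⁅A, H.curvOp K B⁆) := by
  rw [HyperHermitian.mem_cubicDiscriminants_iff hV]
  constructor
  · rintro ⟨u, v, A, h, hA, hK⟩
    exact hA.curvOp_conditions h hV K hK
  · rintro ⟨h1, h2⟩
    exact HyperHermitian.exists_isPrincipal_of_conditions hV h1 h2
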